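/- Let $n\ge 1$, let $0<\alpha\le 1$, and let all functions $f,\varphi$ below take values in a fixed scalar field $\mathbb{K}\in\{\mathbb{R},\mathbb{C}\}$. Let $\mathcal{C}_\alpha$ be the family of functions $\varphi$ on $\mathbb{R}^n$ that vanish outside $\{|x|\le 1\}$ and satisfy $\int_{\mathbb{R}^n}\varphi\,dx=0$ and $|\varphi(x)-\varphi(x')|\le |x-x'|^\alpha$ for all $x,x'\in\mathbb{R}^n$. Put $\varphi_t(x)=t^{-n}\varphi(x/t)$ for $t>0$. For a locally integrable function $f$ on $\mathbb{R}^n$ define $$A_\alpha(f)(y,t)=\sup_{\varphi\in\mathcal{C}_\alpha}\left|\int_{\mathbb{R}^n}\varphi_t(y-z)f(z)\,dz\right|,\qquad g_\alpha(f)(x)=\left(\int_0^\infty A_\alpha(f)(x,t)^2\,\frac{dt}{t}\right)^{1/2}\in[0,\infty].$$ Let $\Phi$ be a positive, increasing (that is, non-decreasing) function on $(0,\infty)$ for which there is a constant $D=D(\Phi)\ge 1$ with $\Phi(2r)\le D\,\Phi(r)$ for all $r>0$. Write $B(x_0,r)$ for the open ball with center $x_0\in\mathbb{R}^n$ and radius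 $r>0$, and $|E|$ for the Lebesgue measure of $E$. The space $L^{1,\Phi}$ consists of the locally integrable $f$ whose norm $\|f\|_{L^{1,\Phi}}$ is finite, where $\|f\|_{L^{1,\Phi}}$ is the smallest $C\in[0,\infty]$ such that $\int_{B(x_0,r)}|f|\,dx\le C\,\Phi(r)$ for all $x_0\in\mathbb{R}^n$ and $r>0$. The space $WL^{1,\Phi}$ consists of the measurable, almost everywhere finite $h$ with $\|h\|_{WL^{1,\Phi}}<\infty$, where $\|h\|_{WL^{1,\Phi}}$ is the smallest $C\in[0,\infty]$ such that $\sup_{\lambda>0}\lambda\,|\{x\in B(x_0,r):|h(x)|>\lambda\}|\le C\,\Phi(r)$ for all $x_0\in\mathbb{R}^n$ and $r>0$. **Corollary 1.8.** If $D(\Phi)<2^n$, then $g_\alpha$ maps $L^{1,\Phi}$ into $WL^{1,\Phi}$, and there is a constant $C>0$, independent of $f$, such that $$\|g_\alpha(f)\|_{WL^{1,\Phi}}\le C\,\|f\|_{L^{1,\Phi}}\qquad\text{for all } f\in L^{1,\Phi}.$$ -/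

import Mathlib

open MeasureTheory Set
open scoped ENNReal NNReal

noncomputable section

namespace IntrinsicSquare

/-- A growth function: positive and increasing (non-decreasing) on `(0, ∞)`, and doubling with
constant `D ≥ 1`. Only the values of `Φ` on `(0, ∞)` matter. -/
structure IsGrowthFunction (Φ : ℝ → ℝ) (D : ℝ) : Prop where
  pos : ∀ r : ℝ, 0 < r → 0 < Φ r
  mono : MonotoneOn Φ (Ioi 0)
  one_le : 1 ≤ D
  doubling : ∀ r : ℝ, 0 < r → Φ (2 * r) ≤ D * Φ r

/-- The Morrey norm of `L^{1,Φ}`: the smallest `C ∈ [0, ∞]` with `∫_{B(x₀,r)} |f| ≤ C Φ(r)` for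
every ball. -/
def morreyNorm {n : ℕ} {𝕜 : Type*} [RCLike 𝕜] (Φ : ℝ → ℝ)
    (f : EuclideanSpace ℝ (Fin n) → 𝕜) : ℝ≥0∞ :=
  sInf {C : ℝ≥0∞ | ∀ (x₀ : EuclideanSpace ℝ (Fin n)) (r : ℝ), 0 < r →
    ∫⁻ x in Metric.ball x₀ r, ‖f x‖ₑ ≤ C * ENNReal.ofReal (Φ r)}

/-- Membership in the generalized Morrey space `L^{1,Φ}(ℝⁿ)`. -/
structure MemMorrey {n : ℕ} {𝕜 : Type*} [RCLike 𝕜] (Φ : ℝ → ℝ)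
    (f : EuclideanSpace ℝ (Fin n) → 𝕜) : Prop where
  locallyIntegrable : LocallyIntegrable f volume
  norm_lt_top : morreyNorm Φ f < ∞

/-- The norm of `WL^{1,Φ}`, for a non-negative extended-valued `h`: the smallest `C ∈ [0, ∞]`
with `sup_{s > 0} s |{x ∈ B(x₀,r) : h(x) > s}| ≤ C Φ(r)` for every ball. -/
def weakMorreyNorm {n : ℕ} (Φ : ℝ → ℝ) (h : EuclideanSpace ℝ (Fin n) → ℝ≥0∞) : ℝ≥0∞ :=
  sInf {C : ℝ≥0∞ | ∀ (x₀ : EuclideanSpace ℝ (Fin n)) (r : ℝ), 0 < r →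
    ⨆ (s : ℝ) (_ : 0 < s),
      ENNReal.ofReal s * volume {x | x ∈ Metric.ball x₀ r ∧ ENNReal.ofReal s < h x}
    ≤ C * ENNReal.ofReal (Φ r)}

/-- Membership of a non-negative function in the generalized weak Morrey space `WL^{1,Φ}(ℝⁿ)`. -/
structure MemWeakMorrey {n : ℕ} (Φ : ℝ → ℝ) (h : EuclideanSpace ℝ (Fin n) → ℝ≥0∞) : Prop where
  measurable : Measurable h
  ae_lt_top : ∀ᵐ x, h x < ∞
  norm_lt_top : weakMorreyNorm Φ h < ∞

/-- The family `𝒞_α` of test kernels. -/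
structure IsKernel {n : ℕ} {𝕜 : Type*} [RCLike 𝕜] (α : ℝ)
    (φ : EuclideanSpace ℝ (Fin n) → 𝕜) : Prop where
  support_subset : Function.support φ ⊆ Metric.closedBall 0 1
  integral_eq_zero : ∫ x, φ x = 0
  holder : ∀ x x' : EuclideanSpace ℝ (Fin n), ‖φ x - φ x'‖ ≤ ‖x - x'‖ ^ α

/-- The dilation `φ_t(x) = t⁻ⁿ φ(x / t)`. -/
def dilate {n : ℕ} {𝕜 : Type*} [RCLike 𝕜] (t : ℝ) (φ : EuclideanSpace ℝ (Fin n) → 𝕜)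
    (x : EuclideanSpace ℝ (Fin n)) : 𝕜 :=
  (t ^ n)⁻¹ • φ (t⁻¹ • x)

/-- `A_α(f)(y,t) = sup_{φ ∈ 𝒞_α} |(f * φ_t)(y)|`. -/
def intrinsicA {n : ℕ} {𝕜 : Type*} [RCLike 𝕜] (α : ℝ) (f : EuclideanSpace ℝ (Fin n) → 𝕜)
    (y : EuclideanSpace ℝ (Fin n)) (t : ℝ) : ℝ≥0∞ :=
  ⨆ (φ : EuclideanSpace ℝ (Fin n) → 𝕜) (_ : IsKernel α φ),
    ‖∫ z, dilate t φ (y - z) * f z‖ₑ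

/-- The intrinsic Littlewood–Paley `g`-function
`g_α(f)(x) = (∫₀^∞ A_α(f)(x,t)² dt/t)^{1/2}`, with values in `[0, ∞]`. -/
def intrinsicG {n : ℕ} {𝕜 : Type*} [RCLike 𝕜] (α : ℝ) (f : EuclideanSpace ℝ (Fin n) → 𝕜)
    (x : EuclideanSpace ℝ (Fin n)) : ℝ≥0∞ :=
  (∫⁻ t in Ioi (0 : ℝ), intrinsicA α f x t ^ 2 / ENNReal.ofReal t) ^ (1 / 2 : ℝ)

end IntrinsicSquare

end

/-!
A kernel of `𝒞_α` at `x` and scale `t` is a mean-zero bump, bounded by `t⁻ⁿ` and Hölder of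
exponent `α`, so `A_α` at scale `t ∈ (2ᵏ, 2ᵏ⁺¹]` is controlled by `A_α` at scale `2ᵏ⁺¹`, and `g_α`
by a sum over dyadic scales. Two bumps whose scales differ by the factor `2ᵈ` have a pairing that
decays geometrically in `|d|`; testing against nearly optimal bumps, Schur's test turns this
almost orthogonality into the `L²` bound for `g_α`.

The weak type (1,1) bound follows by the Calderón–Zygmund decomposition at dyadic stopping cubes:
an atom carried by a cube is seen, away from the cube, only by larger bumps, on which it pairs
with the same geometric decay.

In a ball of radius `r`, split `f` along the concentric ball of radius `2 * r`. The inner part obeys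
the weak type (1,1) bound. The outer part is invisible at scales up to `r`, and at scale `2ⁱ r` the
Morrey condition and the doubling of `Φ` bound `A_α` by a multiple of `(D / 2ⁿ)ⁱ r⁻ⁿ Φ(r)`, a
convergent series because `D < 2ⁿ`.
-/

noncomputable section

namespace IntrinsicSquare

open Metric Filter Topology

variable {n : ℕ} {𝕜 : Type*} [RCLike 𝕜] {α : ℝ}

local notation "𝔼" => EuclideanSpace ℝ (Fin n)

/-! ### Bumps -/

/-- The volume of the closed unit ball of `ℝⁿ`. -/
def unitBallVolume (n : ℕ) : ℝ≥0∞ :=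
  volume (closedBall (0 : EuclideanSpace ℝ (Fin n)) 1)

lemma unitBallVolume_ne_top : unitBallVolume n ≠ ∞ :=
  measure_closedBall_lt_top.ne

lemma volume_closedBall_eq (x : 𝔼) {r : ℝ} (hr : 0 ≤ r) :
    volume (closedBall x r) = ENNReal.ofReal (r ^ n) * unitBallVolume n := by
  rw [Measure.addHaar_closedBall' volume x hr, finrank_euclideanSpace_fin, unitBallVolume]

/-- A translated and dilated test kernel, adapted to the ball of centre `x` and radius `t`. -/
structure IsBump (α : ℝ) (x : 𝔼) (t : ℝ) (ψ : 𝔼 → 𝕜) : Prop where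
  eq_zero : ∀ z ∉ closedBall x t, ψ z = 0
  integral_eq_zero : ∫ z, ψ z = 0
  holder : ∀ z z', ‖ψ z - ψ z'‖ ≤ (t ^ n)⁻¹ * (‖z - z'‖ / t) ^ α

lemma IsKernel.isBump {φ : 𝔼 → 𝕜} (hφ : IsKernel α φ) (x : 𝔼) {t : ℝ} (ht : 0 < t) :
    IsBump α x t fun z => dilate t φ (x - z) where
  eq_zero z hz := by
    have hmem : t⁻¹ • (x - z) ∉ Function.support φ := fun hmem => hz <| by
      have h := hφ.support_subset hmem
      rwa [mem_closedBall_zero_iff, norm_smul, norm_inv, Real.norm_of_nonneg ht.le,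
        inv_mul_le_one₀ ht, ← mem_closedBall_iff_norm'] at h
    rw [dilate, Function.notMem_support.1 hmem, smul_zero]
  integral_eq_zero := by
    rw [integral_sub_left_eq_self (dilate t φ)]
    simp only [dilate]
    rw [integral_smul, Measure.integral_comp_smul, hφ.integral_eq_zero, smul_zero, smul_zero]
  holder z z' := by
    have harg : ‖t⁻¹ • (x - z) - t⁻¹ • (x - z')‖ = ‖z - z'‖ / t := by
      rw [← smul_sub, sub_sub_sub_cancel_left, norm_smul, norm_inv, Real.norm_of_nonneg ht.le,
        norm_sub_rev, inv_mul_eq_div]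
    rw [dilate, dilate, ← smul_sub, norm_smul, Real.norm_of_nonneg (by positivity), ← harg]
    gcongr
    exact hφ.holder _ _

lemma enorm_setIntegral_mul_le_of_setIntegral_eq_zero {X : Type*} [MeasurableSpace X]
    {μ : Measure X} {S : Set X} (hS : MeasurableSet S) {χ u : X → 𝕜}
    (hχ : AEStronglyMeasurable χ (μ.restrict S)) (hu : IntegrableOn u S μ)
    (hu0 : ∫ z in S, u z ∂μ = 0) (a : 𝕜) {A : ℝ} (hA : ∀ z ∈ S, ‖χ z - a‖ ≤ A) :
    ‖∫ z in S, χ z * u z ∂μ‖ₑ ≤ ENNReal.ofReal A * ∫⁻ z in S, ‖u z‖ₑ ∂μ := by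
  have hbound : ∀ᵐ z ∂μ.restrict S, ‖χ z - a‖ ≤ A :=
    (ae_restrict_mem hS).mono hA
  have hint : Integrable (fun z => (χ z - a) * u z) (μ.restrict S) :=
    hu.bdd_mul (hχ.sub aestronglyMeasurable_const) hbound
  have hsub : ∫ z in S, χ z * u z ∂μ = ∫ z in S, (χ z - a) * u z ∂μ := by
    have hsplit : ∀ z, χ z * u z = (χ z - a) * u z + a * u z := fun z => by ring
    simp_rw [hsplit]
    rw [integral_add hint (hu.const_mul _), integral_const_mul, hu0, mul_zero, add_zero]
  rw [hsub]
  refine (enorm_integral_le_lintegral_enorm _).trans ?_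
  rw [← lintegral_const_mul' _ _ ENNReal.ofReal_ne_top]
  refine lintegral_mono_ae (hbound.mono fun z hz => ?_)
  rw [enorm_mul, ← ofReal_norm (χ z - a)]
  gcongr

namespace IsBump

variable {x y : EuclideanSpace ℝ (Fin n)} {s t : ℝ} {ψ χ : EuclideanSpace ℝ (Fin n) → 𝕜}

lemma continuous (hα : 0 < α) (hψ : IsBump α x t ψ) : Continuous ψ := by
  refine continuous_iff_continuousAt.2 fun z => tendsto_iff_norm_sub_tendsto_zero.2 ?_
  have hmod : Continuous fun w : 𝔼 => (t ^ n)⁻¹ * (‖w - z‖ / t) ^ α :=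
    continuous_const.mul (Continuous.rpow_const (by fun_prop) fun _ => Or.inr hα.le)
  have hlim := hmod.tendsto z
  simp only [sub_self, norm_zero, zero_div, Real.zero_rpow hα.ne', mul_zero] at hlim
  exact squeeze_zero (fun _ => norm_nonneg _) (fun w => hψ.holder w z) hlim

lemma hasCompactSupport (hψ : IsBump α x t ψ) : HasCompactSupport ψ :=
  HasCompactSupport.intro (isCompact_closedBall x t) hψ.eq_zero

lemma integrable (hα : 0 < α) (hψ : IsBump α x t ψ) : Integrable ψ :=
  (hψ.continuous hα).integrable_of_hasCompactSupport hψ.hasCompactSupport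

lemma integrable_mul (hα : 0 < α) (hψ : IsBump α x t ψ) {f : 𝔼 → 𝕜} (hf : LocallyIntegrable f) :
    Integrable fun z => ψ z * f z := by
  simpa only [smul_eq_mul] using
    hf.integrable_smul_left_of_hasCompactSupport (hψ.continuous hα) hψ.hasCompactSupport

lemma setIntegral_eq_zero (hψ : IsBump α x t ψ) : ∫ z in closedBall x t, ψ z = 0 := by
  rw [setIntegral_eq_integral_of_forall_compl_eq_zero hψ.eq_zero, hψ.integral_eq_zero]

lemma conj (hψ : IsBump α x t ψ) : IsBump α x t fun z => (starRingEnd 𝕜) (ψ z) where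
  eq_zero z hz := by rw [hψ.eq_zero z hz, map_zero]
  integral_eq_zero := by rw [integral_conj, hψ.integral_eq_zero, map_zero]
  holder z z' := by rw [← map_sub, RCLike.norm_conj]; exact hψ.holder z z'

lemma norm_le (hα : 0 < α) (ht : 0 < t) (hψ : IsBump α x t ψ) (z : 𝔼) :
    ‖ψ z‖ ≤ 2 ^ α * (t ^ n)⁻¹ := by
  by_cases hz : z ∈ closedBall x t
  swap
  · rw [hψ.eq_zero z hz, norm_zero]
    positivity
  have hball : 0 < volume.real (closedBall x t) :=
    ENNReal.toReal_pos (measure_closedBall_pos volume x ht).ne' measure_closedBall_lt_top.ne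
  -- `ψ` has mean value zero, so `ψ z` is the mean of the differences `ψ z - ψ w` over the ball
  have hconst : IntegrableOn (fun _ => ψ z) (closedBall x t) :=
    integrableOn_const measure_closedBall_lt_top.ne
  have hmean : ∫ w in closedBall x t, (ψ z - ψ w) = volume.real (closedBall x t) • ψ z := by
    rw [integral_sub hconst (hψ.integrable hα).integrableOn, setIntegral_const,
      hψ.setIntegral_eq_zero, sub_zero]
  have hdiff : ∀ w ∈ closedBall x t, ‖ψ z - ψ w‖ ≤ 2 ^ α * (t ^ n)⁻¹ := fun w hw => by
    have hdist : ‖z - w‖ / t ≤ 2 := by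
      rw [div_le_iff₀ ht, ← dist_eq_norm]
      linarith [dist_triangle_right z w x, mem_closedBall.1 hz, mem_closedBall.1 hw]
    rw [mul_comm]
    exact (hψ.holder z w).trans (by gcongr)
  have hle := norm_setIntegral_le_of_norm_le_const (μ := volume) measure_closedBall_lt_top hdiff
  rw [hmean, norm_smul, Real.norm_of_nonneg hball.le, mul_comm] at hle
  exact le_of_mul_le_mul_right hle hball

lemma enorm_le (hα : 0 < α) (ht : 0 < t) (hψ : IsBump α x t ψ) (z : 𝔼) :
    ‖ψ z‖ₑ ≤ ENNReal.ofReal (2 ^ α * (t ^ n)⁻¹) := by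
  rw [← ofReal_norm]
  exact ENNReal.ofReal_le_ofReal (hψ.norm_le hα ht z)

lemma lintegral_enorm_le (hα : 0 < α) (ht : 0 < t) (hψ : IsBump α x t ψ) :
    ∫⁻ z in closedBall x t, ‖ψ z‖ₑ ≤ ENNReal.ofReal (2 ^ α) * unitBallVolume n :=
  calc ∫⁻ z in closedBall x t, ‖ψ z‖ₑ
      ≤ ∫⁻ _ in closedBall x t, ENNReal.ofReal (2 ^ α * (t ^ n)⁻¹) :=
        lintegral_mono (hψ.enorm_le hα ht)
    _ = ENNReal.ofReal (2 ^ α) * unitBallVolume n := by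
        rw [setLIntegral_const, volume_closedBall_eq x ht.le, ← mul_assoc,
          ← ENNReal.ofReal_mul (by positivity), inv_mul_cancel_right₀ (by positivity)]

lemma enorm_integral_mul_le (hα : 0 < α) (ht : 0 < t) (hψ : IsBump α x t ψ) (f : 𝔼 → 𝕜) :
    ‖∫ z, ψ z * f z‖ₑ ≤
      ENNReal.ofReal (2 ^ α * (t ^ n)⁻¹) * ∫⁻ z in closedBall x t, ‖f z‖ₑ := by
  rw [← setIntegral_eq_integral_of_forall_compl_eq_zero (s := closedBall x t)
    fun z hz => by rw [hψ.eq_zero z hz, zero_mul]]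
  refine (enorm_integral_le_lintegral_enorm _).trans ?_
  rw [← lintegral_const_mul' _ _ ENNReal.ofReal_ne_top]
  refine lintegral_mono fun z => ?_
  rw [enorm_mul]
  gcongr
  exact hψ.enorm_le hα ht z

lemma enorm_setIntegral_mul_le (hα : 0 < α) (ht : 0 < t) (hψ : IsBump α x t ψ) {S : Set 𝔼}
    (hS : MeasurableSet S) {u : 𝔼 → 𝕜} (hu : IntegrableOn u S) (hu0 : ∫ z in S, u z = 0)
    {c : 𝔼} {ρ : ℝ} (hρ : ∀ z ∈ S, dist z c ≤ ρ) :
    ‖∫ z in S, ψ z * u z‖ₑ ≤ ENNReal.ofReal ((t ^ n)⁻¹ * (ρ / t) ^ α) * ∫⁻ z in S, ‖u z‖ₑ := by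
  refine enorm_setIntegral_mul_le_of_setIntegral_eq_zero hS
    (hψ.continuous hα).aestronglyMeasurable hu hu0 (ψ c) fun z hz => (hψ.holder z c).trans ?_
  rw [← dist_eq_norm]
  gcongr
  exact hρ z hz

lemma enorm_integral_mul_bump_le (hα : 0 < α) (hs : 0 < s) (ht : 0 < t) (hψ : IsBump α x s ψ)
    (hχ : IsBump α y t χ) :
    ‖∫ z, χ z * ψ z‖ₑ ≤ ENNReal.ofReal ((t ^ n)⁻¹ * (s / t) ^ α) *
      (ENNReal.ofReal (2 ^ α) * unitBallVolume n) := by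
  rw [← setIntegral_eq_integral_of_forall_compl_eq_zero (s := closedBall x s)
    fun z hz => by rw [hψ.eq_zero z hz, mul_zero]]
  refine (hχ.enorm_setIntegral_mul_le hα ht measurableSet_closedBall
    (hψ.integrable hα).integrableOn hψ.setIntegral_eq_zero fun z hz => hz).trans ?_
  gcongr
  exact hψ.lintegral_enorm_le hα hs

lemma integral_mul_bump_eq_zero (hψ : IsBump α x s ψ) (hχ : IsBump α y t χ)
    (hxy : s + t < dist x y) : ∫ z, χ z * ψ z = 0 := by
  refine integral_eq_zero_of_ae (Eventually.of_forall fun z => ?_)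
  by_cases hz : z ∈ closedBall x s
  · have hz' : z ∉ closedBall y t := fun hz' => by
      rw [mem_closedBall] at hz hz'
      linarith [dist_triangle_left x y z]
    exact mul_eq_zero_of_left (hχ.eq_zero z hz') _
  · exact mul_eq_zero_of_right _ (hψ.eq_zero z hz)

end IsBump

/-! ### The intrinsic maximal averages and square function -/

lemma dilate_dilate (s t : ℝ) (φ : 𝔼 → 𝕜) : dilate t (dilate s φ) = dilate (s * t) φ := by
  funext x
  simp only [dilate, smul_smul, mul_pow, mul_inv]
  rw [mul_comm]

lemma dilate_smul (t c : ℝ) (φ : 𝔼 → 𝕜) : dilate t (c • φ) = c • dilate t φ := by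
  funext x
  simp only [dilate, Pi.smul_apply]
  exact smul_comm _ _ _

lemma IsKernel.zero : IsKernel α (0 : 𝔼 → 𝕜) where
  support_subset := by simp
  integral_eq_zero := by simp
  holder x x' := by
    simp only [Pi.zero_apply, sub_zero, norm_zero]
    positivity

namespace IsKernel

variable {φ : EuclideanSpace ℝ (Fin n) → 𝕜}

lemma continuous (hα : 0 < α) (hφ : IsKernel α φ) : Continuous φ := by
  simpa [dilate, Function.comp_def] using
    ((hφ.isBump 0 one_pos).continuous hα).comp continuous_neg

lemma smul_dilate (hφ : IsKernel α φ) {s : ℝ} (hs : 0 < s) (hs1 : s ≤ 1) :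
    IsKernel α ((s ^ n * s ^ α) • dilate s φ) where
  support_subset x hx := by
    have hmem : s⁻¹ • x ∈ Function.support φ := fun h0 => hx <| by
      simp only [Pi.smul_apply, dilate, h0, smul_zero]
    have h := hφ.support_subset hmem
    rw [mem_closedBall_zero_iff, norm_smul, norm_inv, Real.norm_of_nonneg hs.le,
      inv_mul_le_one₀ hs] at h
    exact mem_closedBall_zero_iff.2 (h.trans hs1)
  integral_eq_zero := by
    simp only [Pi.smul_apply, dilate]
    rw [integral_smul, integral_smul, Measure.integral_comp_smul, hφ.integral_eq_zero,
      smul_zero, smul_zero, smul_zero]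
  holder x x' := by
    simp only [Pi.smul_apply, dilate]
    rw [smul_smul, smul_smul, ← smul_sub, norm_smul, Real.norm_of_nonneg (by positivity)]
    refine (mul_le_mul_of_nonneg_left (hφ.holder _ _) (by positivity)).trans_eq ?_
    rw [← smul_sub, norm_smul, norm_inv, Real.norm_of_nonneg hs.le,
      Real.mul_rpow (by positivity) (norm_nonneg _), Real.inv_rpow hs.le]
    field_simp

lemma enorm_integral_le_intrinsicA (hφ : IsKernel α φ) (f : 𝔼 → 𝕜) (y : 𝔼) (t : ℝ) :
    ‖∫ z, dilate t φ (y - z) * f z‖ₑ ≤ intrinsicA α f y t :=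
  le_iSup₂ (f := fun φ (_ : IsKernel α φ) => ‖∫ z, dilate t φ (y - z) * f z‖ₑ) φ hφ

lemma continuousAt_integral_dilate (hα : 0 < α) (hφ : IsKernel α φ) {f : 𝔼 → 𝕜}
    (hf : LocallyIntegrable f) (y : 𝔼) {t : ℝ} (ht : 0 < t) :
    ContinuousAt (fun p : 𝔼 × ℝ => ∫ z, dilate p.2 φ (p.1 - z) * f z) (y, t) := by
  have hnhds : ball y 1 ×ˢ Ioo (t / 2) (2 * t) ∈ 𝓝 (y, t) :=
    prod_mem_nhds (ball_mem_nhds y one_pos) (Ioo_mem_nhds (by linarith) (by linarith))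
  refine ContinuousOn.continuousAt ?_ hnhds
  simp only [mul_comm (dilate _ φ _)]
  refine continuousOn_integral_bilinear_of_locally_integrable_of_compact_support
    (ContinuousLinearMap.mul 𝕜 𝕜) (isCompact_closedBall y (1 + 2 * t)) ?_ ?_
    (hf.integrableOn_isCompact (isCompact_closedBall y (1 + 2 * t)))
  · have hφc := hφ.continuous hα
    have hne : ∀ q ∈ (ball y 1 ×ˢ Ioo (t / 2) (2 * t)) ×ˢ (univ : Set 𝔼), q.1.2 ≠ 0 :=
      fun q hq => by linarith [hq.1.2.1]
    have harg : ContinuousOn (fun q : (𝔼 × ℝ) × 𝔼 => q.1.2⁻¹ • (q.1.1 - q.2))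
        ((ball y 1 ×ˢ Ioo (t / 2) (2 * t)) ×ˢ univ) :=
      (ContinuousOn.inv₀ (by fun_prop) hne).smul (by fun_prop)
    exact (ContinuousOn.inv₀ (by fun_prop) fun q hq => pow_ne_zero n (hne q hq)).smul
      (hφc.comp_continuousOn harg)
  · intro p z hp hz
    have hp0 : 0 < p.2 := by linarith [hp.2.1]
    refine (hφ.isBump p.1 hp0).eq_zero z fun hz' => hz ?_
    rw [mem_closedBall] at hz' ⊢
    linarith [dist_triangle z p.1 y, mem_ball.1 hp.1, hp.2.2]

end IsKernel

lemma intrinsicA_le_of_le (f : 𝔼 → 𝕜) (x : 𝔼) {t T : ℝ} (ht : 0 < t) (htT : t ≤ T) :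
    intrinsicA α f x t ≤ ENNReal.ofReal ((T / t) ^ n * (T / t) ^ α) * intrinsicA α f x T := by
  have hT : 0 < T := ht.trans_le htT
  have hs : 0 < t / T := by positivity
  refine iSup₂_le fun φ hφ => ?_
  have hker := hφ.smul_dilate hs ((div_le_one hT).2 htT)
  have hscale : dilate t φ = ((T / t) ^ n * (T / t) ^ α) •
      dilate T (((t / T) ^ n * (t / T) ^ α) • dilate (t / T) φ) := by
    rw [dilate_smul, dilate_dilate, div_mul_cancel₀ t hT.ne', smul_smul, ← inv_div t T,
      inv_pow, Real.inv_rpow hs.le, ← mul_inv, inv_mul_cancel₀ (by positivity), one_smul]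
  have hint : ∀ c : ℝ, ∀ k : 𝔼 → 𝕜,
      ∫ z, (c • k) (x - z) * f z = c • ∫ z, k (x - z) * f z := fun c k => by
    simp only [Pi.smul_apply, smul_mul_assoc]
    exact integral_smul _ _
  rw [hscale, hint, enorm_smul, Real.enorm_of_nonneg (by positivity)]
  gcongr
  exact hker.enorm_integral_le_intrinsicA f x T

lemma intrinsicA_add_le (hα : 0 < α) {f g : 𝔼 → 𝕜} (hf : LocallyIntegrable f)
    (hg : LocallyIntegrable g) (x : 𝔼) {t : ℝ} (ht : 0 < t) :
    intrinsicA α (f + g) x t ≤ intrinsicA α f x t + intrinsicA α g x t := by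
  refine iSup₂_le fun φ hφ => ?_
  have hbump := hφ.isBump x ht
  simp only [Pi.add_apply, mul_add]
  rw [integral_add (hbump.integrable_mul hα hf) (hbump.integrable_mul hα hg)]
  exact (enorm_add_le _ _).trans (add_le_add (hφ.enorm_integral_le_intrinsicA f x t)
    (hφ.enorm_integral_le_intrinsicA g x t))

lemma measurable_indicator_intrinsicA (hα : 0 < α) {f : 𝔼 → 𝕜} (hf : LocallyIntegrable f) :
    Measurable ({p : 𝔼 × ℝ | 0 < p.2}.indicator fun p => intrinsicA α f p.1 p.2) := by
  refine LowerSemicontinuous.measurable ?_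
  rintro ⟨y, t⟩ a ha
  have ht : 0 < t := by
    by_contra ht
    rw [indicator_of_notMem (show (y, t) ∉ {p : 𝔼 × ℝ | 0 < p.2} from ht)] at ha
    exact not_lt_zero ha
  rw [indicator_of_mem (show (y, t) ∈ {p : 𝔼 × ℝ | 0 < p.2} from ht), intrinsicA] at ha
  simp only [lt_iSup_iff] at ha
  obtain ⟨φ, hφ, ha⟩ := ha
  filter_upwards [(hφ.continuousAt_integral_dilate hα hf y ht).enorm.eventually (lt_mem_nhds ha),
    continuous_snd.continuousAt.eventually (lt_mem_nhds ht)] with q hq hq0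
  rw [indicator_of_mem (show q ∈ {p : 𝔼 × ℝ | 0 < p.2} from hq0)]
  exact hq.trans_le (hφ.enorm_integral_le_intrinsicA f q.1 q.2)

lemma measurable_intrinsicA (hα : 0 < α) {f : 𝔼 → 𝕜} (hf : LocallyIntegrable f) {t : ℝ}
    (ht : 0 < t) : Measurable fun x => intrinsicA α f x t := by
  have h := (measurable_indicator_intrinsicA hα hf).comp (measurable_prodMk_right (y := t))
  simpa only [Function.comp_def, indicator, mem_ofPred_eq, ht, if_true] using h

lemma aemeasurable_intrinsicA (hα : 0 < α) {f : 𝔼 → 𝕜} (hf : LocallyIntegrable f) (x : 𝔼) :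
    AEMeasurable (intrinsicA α f x) (volume.restrict (Ioi 0)) :=
  (aemeasurable_indicator_iff measurableSet_Ioi).1
    ((measurable_indicator_intrinsicA hα hf).comp measurable_prodMk_left).aemeasurable

lemma measurable_intrinsicG (hα : 0 < α) {f : 𝔼 → 𝕜} (hf : LocallyIntegrable f) :
    Measurable (intrinsicG α f) := by
  have hmeas := ((measurable_indicator_intrinsicA hα hf).pow_const 2).div
    (ENNReal.measurable_ofReal.comp measurable_snd)
  have hG : intrinsicG α f = fun x => (∫⁻ t in Ioi (0 : ℝ),
      ({p : 𝔼 × ℝ | 0 < p.2}.indicator (fun p => intrinsicA α f p.1 p.2) (x, t)) ^ 2 /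
        ENNReal.ofReal t) ^ (1 / 2 : ℝ) := by
    funext x
    rw [intrinsicG]
    congr 1
    refine setLIntegral_congr_fun measurableSet_Ioi fun t ht => ?_
    rw [indicator_of_mem (show (x, t) ∈ {p : 𝔼 × ℝ | 0 < p.2} from ht)]
  rw [hG]
  exact (Measurable.lintegral_prod_right' hmeas).pow_const _

lemma intrinsicG_eq_lintegral_rpow (f : 𝔼 → 𝕜) (x : 𝔼) :
    intrinsicG α f x = (∫⁻ t in Ioi (0 : ℝ),
      (intrinsicA α f x t * ENNReal.ofReal t ^ (-(1 / 2) : ℝ)) ^ (2 : ℝ)) ^ (1 / 2 : ℝ) := by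
  rw [intrinsicG]
  congr 2 with t
  rw [ENNReal.mul_rpow_of_nonneg _ _ zero_le_two, ← ENNReal.rpow_mul, div_eq_mul_inv,
    ← ENNReal.rpow_neg_one, ← ENNReal.rpow_natCast]
  norm_num

lemma intrinsicG_add_le (hα : 0 < α) {f g : 𝔼 → 𝕜} (hf : LocallyIntegrable f)
    (hg : LocallyIntegrable g) (x : 𝔼) :
    intrinsicG α (f + g) x ≤ intrinsicG α f x + intrinsicG α g x := by
  have hweight : Measurable fun t : ℝ => ENNReal.ofReal t ^ (-(1 / 2) : ℝ) :=
    ENNReal.measurable_ofReal.pow_const _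
  simp only [intrinsicG_eq_lintegral_rpow]
  refine le_trans ?_ (ENNReal.lintegral_Lp_add_le
    ((aemeasurable_intrinsicA hα hf x).mul hweight.aemeasurable)
    ((aemeasurable_intrinsicA hα hg x).mul hweight.aemeasurable) one_le_two)
  gcongr 1
  refine setLIntegral_mono' measurableSet_Ioi fun t ht => ?_
  simp only [Pi.add_apply]
  rw [← add_mul]
  gcongr
  exact intrinsicA_add_le hα hf hg x ht

lemma intrinsicG_sq (f : 𝔼 → 𝕜) (x : 𝔼) :
    intrinsicG α f x ^ 2 = ∫⁻ t in Ioi (0 : ℝ), intrinsicA α f x t ^ 2 / ENNReal.ofReal t := by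
  rw [intrinsicG, ← ENNReal.rpow_natCast, ← ENNReal.rpow_mul]
  norm_num

lemma setLIntegral_intrinsicA_sq_le (hα : 0 < α) (f : 𝔼 → 𝕜) (x : 𝔼) {T : ℝ} (hT : 0 < T) :
    ∫⁻ t in Ioc T (2 * T), intrinsicA α f x t ^ 2 / ENNReal.ofReal t ≤
      (ENNReal.ofReal (2 ^ n * 2 ^ α) * intrinsicA α f x (2 * T)) ^ 2 := by
  have hbound : ∀ t ∈ Ioc T (2 * T), intrinsicA α f x t ^ 2 / ENNReal.ofReal t ≤
      (ENNReal.ofReal (2 ^ n * 2 ^ α) * intrinsicA α f x (2 * T)) ^ 2 / ENNReal.ofReal T := by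
    intro t ht
    have ht0 : 0 < t := hT.trans ht.1
    have hratio : 2 * T / t ≤ 2 := (div_le_iff₀ ht0).2 (by linarith [ht.1])
    gcongr
    · refine (intrinsicA_le_of_le f x ht0 ht.2).trans ?_
      gcongr
    · exact ht.1.le
  refine (setLIntegral_mono' measurableSet_Ioc hbound).trans_eq ?_
  rw [setLIntegral_const, Real.volume_Ioc, two_mul, add_sub_cancel_right,
    ENNReal.div_mul_cancel (by simpa using hT) ENNReal.ofReal_ne_top]

lemma intrinsicG_sq_le_tsum (hα : 0 < α) (f : 𝔼 → 𝕜) (x : 𝔼) {r : ℝ} (hr : 0 < r) :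
    intrinsicG α f x ^ 2 ≤
      ∑' k : ℤ, (ENNReal.ofReal (2 ^ n * 2 ^ α) * intrinsicA α f x (2 ^ k * r)) ^ 2 := by
  have hcover : Ioi (0 : ℝ) ⊆ ⋃ k : ℤ, Ioc (2 ^ k * r) (2 * (2 ^ k * r)) := fun t ht => by
    obtain ⟨k, hk⟩ := exists_mem_Ioc_zpow (div_pos ht hr) one_lt_two
    rw [zpow_add_one₀ two_ne_zero, mul_comm _ (2 : ℝ)] at hk
    refine mem_iUnion.2 ⟨k, (lt_div_iff₀ hr).1 hk.1, ?_⟩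
    rw [← mul_assoc]
    exact (div_le_iff₀ hr).1 hk.2
  rw [intrinsicG_sq, ← (Equiv.addRight (1 : ℤ)).tsum_eq]
  refine (lintegral_mono_set hcover).trans ((lintegral_iUnion_le _ _).trans ?_)
  refine ENNReal.tsum_le_tsum fun k => ?_
  rw [Equiv.coe_addRight, zpow_add_one₀ two_ne_zero, mul_comm _ (2 : ℝ), mul_assoc]
  exact setLIntegral_intrinsicA_sq_le hα f x (by positivity)

lemma intrinsicG_le_tsum (hα : 0 < α) (f : 𝔼 → 𝕜) (x : 𝔼) {r : ℝ} (hr : 0 < r) :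
    intrinsicG α f x ≤
      ENNReal.ofReal (2 ^ n * 2 ^ α) * ∑' k : ℤ, intrinsicA α f x (2 ^ k * r) := by
  rw [← ENNReal.tsum_mul_left, ← ENNReal.pow_le_pow_left_iff two_ne_zero]
  refine (intrinsicG_sq_le_tsum hα f x hr).trans ?_
  simp only [sq]
  rw [← ENNReal.tsum_mul_left]
  exact ENNReal.tsum_le_tsum fun k => mul_le_mul_left (ENNReal.le_tsum k) _

/-! ### Dyadic cubes -/

/-- Indices of the dyadic cubes of `ℝⁿ`: the pair `(k, m)` stands for the half-open cube
`2ᵏ(m + [0,1)ⁿ)`. -/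
abbrev DyadicIndex (n : ℕ) : Type :=
  ℤ × (Fin n → ℤ)

/-- The index of the dyadic cube of side `2 ^ k` which contains `x`. -/
def cubeAt (k : ℤ) (x : 𝔼) : DyadicIndex n :=
  (k, fun j => ⌊x j / 2 ^ k⌋)

/-- The half-open dyadic cube with a given index. -/
def cube (i : DyadicIndex n) : Set 𝔼 :=
  {x | cubeAt i.1 x = i}

/-- The lower corner of a dyadic cube. -/
def corner (i : DyadicIndex n) : 𝔼 :=
  WithLp.toLp 2 fun j => 2 ^ i.1 * (i.2 j : ℝ)

lemma mem_cube_cubeAt (k : ℤ) (x : 𝔼) : x ∈ cube (cubeAt k x) :=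
  rfl

lemma measurable_cubeAt (k : ℤ) : Measurable (cubeAt (n := n) k) := by
  refine measurable_const.prodMk (measurable_pi_iff.2 fun j => Int.measurable_floor.comp ?_)
  fun_prop

lemma measurableSet_cube (i : DyadicIndex n) : MeasurableSet (cube i) :=
  measurable_cubeAt i.1 (measurableSet_singleton i)

lemma disjoint_cube {i j : DyadicIndex n} (hscale : i.1 = j.1) (hne : i ≠ j) :
    Disjoint (cube i) (cube j) :=
  disjoint_left.2 fun x hi hj => hne <|
    calc i = cubeAt i.1 x := hi.symm
      _ = cubeAt j.1 x := by rw [hscale]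
      _ = j := hj

lemma cubeAt_add_one (k : ℤ) (x : 𝔼) :
    cubeAt (k + 1) x = (k + 1, fun j => (cubeAt k x).2 j / 2) := by
  refine Prod.ext rfl (funext fun j => ?_)
  have hfloor := Int.floor_div_natCast (x j / 2 ^ k) 2
  simp only [cubeAt]
  rw [zpow_add_one₀ two_ne_zero, ← div_div]
  exact_mod_cast hfloor

lemma cubeAt_eq_of_le {k j : ℤ} (hkj : k ≤ j) {x y : 𝔼} (h : cubeAt k x = cubeAt k y) :
    cubeAt j x = cubeAt j y := by
  induction j, hkj using Int.leInduction with
  | base => exact h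
  | succ j _ ih => rw [cubeAt_add_one, cubeAt_add_one, ih]

lemma mem_cube_iff {i : DyadicIndex n} {x : 𝔼} :
    x ∈ cube i ↔ ∀ j, x j ∈ Ico ((2 : ℝ) ^ i.1 * i.2 j) (2 ^ i.1 * i.2 j + 2 ^ i.1) := by
  have hside : (0 : ℝ) < 2 ^ i.1 := by positivity
  simp only [cube, cubeAt, mem_ofPred_eq, Prod.ext_iff, true_and, funext_iff, Int.floor_eq_iff,
    mem_Ico]
  refine forall_congr' fun j => ?_
  rw [le_div_iff₀ hside, div_lt_iff₀ hside]
  constructor <;> rintro ⟨h, h'⟩ <;> constructor <;> linarith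

lemma corner_mem_cube (i : DyadicIndex n) : corner i ∈ cube i := by
  refine mem_cube_iff.2 fun j => ?_
  have hside : (0 : ℝ) < 2 ^ i.1 := by positivity
  simp [corner, hside]

lemma dist_le_of_mem_cube {i : DyadicIndex n} {x y : 𝔼} (hx : x ∈ cube i) (hy : y ∈ cube i) :
    dist x y ≤ √n * 2 ^ i.1 := by
  rw [EuclideanSpace.dist_eq]
  refine Real.sqrt_le_iff.2 ⟨by positivity, ?_⟩
  rw [mul_pow, Real.sq_sqrt (by positivity)]
  calc ∑ j, dist (x j) (y j) ^ 2 ≤ ∑ _j : Fin n, ((2 : ℝ) ^ i.1) ^ 2 := by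
        refine Finset.sum_le_sum fun j _ => pow_le_pow_left₀ dist_nonneg ?_ 2
        have hxj := mem_cube_iff.1 hx j
        have hyj := mem_cube_iff.1 hy j
        rw [Real.dist_eq, abs_le]
        constructor <;> linarith [hxj.1, hxj.2, hyj.1, hyj.2]
    _ = n * ((2 : ℝ) ^ i.1) ^ 2 := by simp

lemma cube_subset_closedBall {i : DyadicIndex n} {x : 𝔼} (hx : x ∈ cube i) :
    cube i ⊆ closedBall x (√n * 2 ^ i.1) :=
  fun _ hy => dist_le_of_mem_cube hy hx

lemma volume_cube (i : DyadicIndex n) : volume (cube i) = ENNReal.ofReal (((2 : ℝ) ^ i.1) ^ n) := by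
  have hpi : cube i = (WithLp.ofLp : 𝔼 → Fin n → ℝ) ⁻¹'
      (Set.univ.pi fun j => Ico ((2 : ℝ) ^ i.1 * i.2 j) (2 ^ i.1 * i.2 j + 2 ^ i.1)) := by
    ext x
    simp only [mem_cube_iff, mem_preimage, mem_univ_pi]
  rw [hpi, (PiLp.volume_preserving_ofLp (Fin n)).measure_preimage
    (MeasurableSet.univ_pi fun j => measurableSet_Ico).nullMeasurableSet, Real.volume_pi_Ico]
  simp only [add_sub_cancel_left, Finset.prod_const, Finset.card_univ, Fintype.card_fin]
  rw [ENNReal.ofReal_pow (by positivity)]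

lemma volume_cube_ne_zero (i : DyadicIndex n) : volume (cube i) ≠ 0 := by
  rw [volume_cube]
  exact (ENNReal.ofReal_pos.2 (by positivity)).ne'

lemma volume_cube_ne_top (i : DyadicIndex n) : volume (cube i) ≠ ∞ := by
  rw [volume_cube]
  exact ENNReal.ofReal_ne_top

lemma volume_closedBall_eq_mul_volume_cube (x : 𝔼) {c : ℝ} (hc : 0 ≤ c) (i : DyadicIndex n) :
    volume (closedBall x (c * 2 ^ i.1)) =
      ENNReal.ofReal (c ^ n) * unitBallVolume n * volume (cube i) := by
  rw [volume_closedBall_eq x (by positivity), volume_cube, mul_pow,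
    ENNReal.ofReal_mul (by positivity)]
  ring

lemma lintegral_eq_tsum_cube (k : ℤ) (F : 𝔼 → ℝ≥0∞) :
    ∫⁻ x, F x = ∑' m : Fin n → ℤ, ∫⁻ x in cube (k, m), F x := by
  have hcover : ⋃ m : Fin n → ℤ, cube (k, m) = univ :=
    eq_univ_of_forall fun x => mem_iUnion.2 ⟨(cubeAt k x).2, mem_cube_cubeAt k x⟩
  rw [← lintegral_iUnion (fun m => measurableSet_cube (k, m))
    fun m m' hne => disjoint_cube rfl fun h => hne (Prod.ext_iff.1 h).2, hcover, setLIntegral_univ]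

/-! ### Almost orthogonal families -/

section AlmostOrthogonal

variable {ι : Type*} {s : Finset ι} {w : ι → ℝ≥0} {C : ℝ≥0}

lemma sum_sum_mul_le_of_row_sum_le {K : ι → ι → ℝ} (hK : ∀ i j, 0 ≤ K i j)
    (hsymm : ∀ i j, K i j = K j i) (hrow : ∀ i ∈ s, ∑ j ∈ s, w j * K i j ≤ C) (a : ι → ℝ) :
    ∑ i ∈ s, ∑ j ∈ s, w i * w j * K i j * (a i * a j) ≤ C * ∑ i ∈ s, w i * a i ^ 2 := by
  have hdiag : ∑ i ∈ s, ∑ j ∈ s, w i * w j * K i j * a i ^ 2 ≤ C * ∑ i ∈ s, w i * a i ^ 2 := by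
    rw [Finset.mul_sum]
    refine Finset.sum_le_sum fun i hi => ?_
    calc ∑ j ∈ s, w i * w j * K i j * a i ^ 2
        = (∑ j ∈ s, w j * K i j) * (w i * a i ^ 2) := by
          rw [Finset.sum_mul]
          exact Finset.sum_congr rfl fun j _ => by ring
      _ ≤ C * (w i * a i ^ 2) := by gcongr; exact hrow i hi
  have hswap : ∑ i ∈ s, ∑ j ∈ s, w i * w j * K i j * a j ^ 2 =
      ∑ i ∈ s, ∑ j ∈ s, w i * w j * K i j * a i ^ 2 := by
    rw [Finset.sum_comm]
    refine Finset.sum_congr rfl fun i _ => Finset.sum_congr rfl fun j _ => ?_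
    rw [hsymm, mul_comm (w j : ℝ)]
  have hamgm : ∑ i ∈ s, ∑ j ∈ s, w i * w j * K i j * (a i * a j) ≤
      ∑ i ∈ s, ∑ j ∈ s,
        (w i * w j * K i j * a i ^ 2 / 2 + w i * w j * K i j * a j ^ 2 / 2) := by
    refine Finset.sum_le_sum fun i _ => Finset.sum_le_sum fun j _ => ?_
    have hcoeff : 0 ≤ w i * w j * K i j := mul_nonneg (by positivity) (hK i j)
    nlinarith [mul_nonneg hcoeff (sq_nonneg (a i - a j))]
  simp only [Finset.sum_add_distrib, ← Finset.sum_div, hswap] at hamgm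
  linarith

open scoped InnerProductSpace

variable {H : Type*} [NormedAddCommGroup H] [InnerProductSpace 𝕜 H] {v : ι → H}

lemma norm_sum_smul_sq_le (hrow : ∀ i ∈ s, ∑ j ∈ s, w j * ‖⟪v i, v j⟫_𝕜‖ ≤ C) (c : ι → 𝕜) :
    ‖∑ i ∈ s, ((w i : ℝ) * c i : 𝕜) • v i‖ ^ 2 ≤ C * ∑ i ∈ s, w i * ‖c i‖ ^ 2 := by
  refine le_trans ?_ (sum_sum_mul_le_of_row_sum_le (K := fun i j => ‖⟪v i, v j⟫_𝕜‖)
    (fun _ _ => norm_nonneg _) (fun _ _ => norm_inner_symm _ _) hrow fun i => ‖c i‖)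
  rw [← inner_self_eq_norm_sq (𝕜 := 𝕜)]
  refine (RCLike.re_le_norm _).trans ?_
  rw [sum_inner]
  refine (norm_sum_le _ _).trans (Finset.sum_le_sum fun i _ => ?_)
  rw [inner_sum]
  refine (norm_sum_le _ _).trans (Finset.sum_le_sum fun j _ => le_of_eq ?_)
  rw [inner_smul_left, inner_smul_right]
  simp only [norm_mul, RCLike.norm_conj, RCLike.norm_ofReal, NNReal.abs_eq]
  ring

lemma sum_mul_norm_inner_sq_le (hrow : ∀ i ∈ s, ∑ j ∈ s, w j * ‖⟪v i, v j⟫_𝕜‖ ≤ C) (f : H) :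
    ∑ i ∈ s, w i * ‖⟪v i, f⟫_𝕜‖ ^ 2 ≤ C * ‖f‖ ^ 2 := by
  set S : ℝ := ∑ i ∈ s, w i * ‖⟪v i, f⟫_𝕜‖ ^ 2 with hS
  set y : H := ∑ i ∈ s, ((w i : ℝ) * ⟪v i, f⟫_𝕜 : 𝕜) • v i with hy
  have hS_nonneg : 0 ≤ S := Finset.sum_nonneg fun i _ => by positivity
  have hinner : ⟪y, f⟫_𝕜 = (S : 𝕜) := by
    rw [hy, sum_inner, hS]
    push_cast
    refine Finset.sum_congr rfl fun i _ => ?_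
    rw [inner_smul_left, map_mul, RCLike.conj_ofReal, mul_assoc, RCLike.conj_mul]
  have hcs : S ≤ ‖y‖ * ‖f‖ := by
    simpa only [hinner, RCLike.norm_ofReal, abs_of_nonneg hS_nonneg] using
      norm_inner_le_norm (𝕜 := 𝕜) y f
  have hy_le : ‖y‖ ^ 2 ≤ C * S := norm_sum_smul_sq_le hrow _
  rcases hS_nonneg.eq_or_lt with hzero | hpos
  · rw [← hzero]
    positivity
  · refine le_of_mul_le_mul_right ?_ hpos
    calc S * S ≤ (‖y‖ * ‖f‖) * (‖y‖ * ‖f‖) := mul_self_le_mul_self hS_nonneg hcs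
      _ = ‖y‖ ^ 2 * ‖f‖ ^ 2 := by ring
      _ ≤ C * S * ‖f‖ ^ 2 := by gcongr
      _ = C * ‖f‖ ^ 2 * S := by ring

variable {X : Type*} [MeasurableSpace X] {μ : Measure X}

lemma inner_toLp_conj {χ f : X → 𝕜} (hχ : MemLp (fun z => starRingEnd 𝕜 (χ z)) 2 μ)
    (hf : MemLp f 2 μ) : ⟪hχ.toLp, hf.toLp⟫_𝕜 = ∫ z, χ z * f z ∂μ := by
  rw [L2.inner_def]
  refine integral_congr_ae ?_
  filter_upwards [hχ.coeFn_toLp, hf.coeFn_toLp] with z hz hz'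
  rw [hz, hz', RCLike.inner_apply, RCLike.conj_conj, mul_comm]

lemma enorm_toLp_two_sq {f : X → 𝕜} (hf : MemLp f 2 μ) : ‖hf.toLp‖ₑ ^ 2 = ∫⁻ z, ‖f z‖ₑ ^ 2 ∂μ := by
  rw [Lp.enorm_toLp]
  simpa using eLpNorm_nnreal_pow_eq_lintegral (f := f) (μ := μ) (p := 2) two_ne_zero

lemma sum_mul_enorm_integral_mul_sq_le {χ : ι → X → 𝕜}
    (hχ : ∀ i, MemLp (fun z => starRingEnd 𝕜 (χ i z)) 2 μ)
    (hrow : ∀ i ∈ s, ∑ j ∈ s, w j * ‖∫ z, χ i z * starRingEnd 𝕜 (χ j z) ∂μ‖ₑ ≤ C)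
    {f : X → 𝕜} (hf : MemLp f 2 μ) :
    ∑ i ∈ s, w i * ‖∫ z, χ i z * f z ∂μ‖ₑ ^ 2 ≤ C * ∫⁻ z, ‖f z‖ₑ ^ 2 ∂μ := by
  have hgram : ∀ i ∈ s, ∑ j ∈ s, w j * ‖⟪(hχ i).toLp, (hχ j).toLp⟫_𝕜‖ ≤ C := fun i hi => by
    have hrow_i := hrow i hi
    simp only [inner_toLp_conj, enorm_eq_nnnorm, ← coe_nnnorm] at hrow_i ⊢
    exact_mod_cast hrow_i
  have hbound := sum_mul_norm_inner_sq_le hgram hf.toLp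
  rw [← enorm_toLp_two_sq hf]
  simp only [← inner_toLp_conj (hχ _) hf, enorm_eq_nnnorm, ← coe_nnnorm] at hbound ⊢
  exact_mod_cast hbound

end AlmostOrthogonal

/-! ### The `L²` bound -/

/-- The decay of the pairing of two bumps whose scales differ by the factor `2 ^ d`. -/
def scaleDecay (α : ℝ) (d : ℤ) : ℝ≥0∞ :=
  ENNReal.ofReal (((2 : ℝ) ^ (-|d|)) ^ α)

lemma tsum_scaleDecay_ne_top (hα : 0 < α) : ∑' d : ℤ, scaleDecay α d ≠ ∞ := by
  have hlt : ((2 : ℝ)⁻¹) ^ α < 1 := Real.rpow_lt_one (by norm_num) (by norm_num) hα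
  have hgeom : Summable fun k : ℕ => (((2 : ℝ)⁻¹) ^ α) ^ k :=
    summable_geometric_of_lt_one (by positivity) hlt
  have hterm : ∀ k : ℕ, (((2 : ℝ)⁻¹) ^ α) ^ k = ((2 : ℝ) ^ (-(k : ℤ))) ^ α := fun k => by
    rw [Real.rpow_pow_comm (by positivity), inv_pow, zpow_neg, zpow_natCast]
  have hsum : Summable fun d : ℤ => ((2 : ℝ) ^ (-|d|)) ^ α := by
    refine Summable.of_nat_of_neg (hgeom.congr fun k => ?_) (hgeom.congr fun k => ?_)
    · rw [Nat.abs_cast, hterm]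
    · rw [abs_neg, Nat.abs_cast, hterm]
  exact hsum.tsum_ofReal_ne_top

namespace IsBump

variable {k : ℤ} {x : EuclideanSpace ℝ (Fin n)} {ψ : EuclideanSpace ℝ (Fin n) → 𝕜}

lemma enorm_integral_mul_bump_le_scaleDecay (hα : 0 < α) (hψ : IsBump α x (2 ^ k) ψ) {j : ℤ}
    {y : 𝔼} {χ : 𝔼 → 𝕜} (hχ : IsBump α y (2 ^ j) χ) :
    ‖∫ z, ψ z * χ z‖ₑ ≤ ENNReal.ofReal ((((2 : ℝ) ^ max k j) ^ n)⁻¹) *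
      (scaleDecay α (j - k) * (ENNReal.ofReal (2 ^ α) * unitBallVolume n)) := by
  have hk : (0 : ℝ) < 2 ^ k := by positivity
  have hj : (0 : ℝ) < 2 ^ j := by positivity
  rw [scaleDecay, ← mul_assoc, ← ENNReal.ofReal_mul (by positivity)]
  rcases le_total j k with hjk | hkj
  · rw [max_eq_left hjk, abs_of_nonpos (sub_nonpos.2 hjk), neg_neg, zpow_sub₀ two_ne_zero]
    exact hχ.enorm_integral_mul_bump_le hα hj hk hψ
  · rw [max_eq_right hkj, abs_of_nonneg (sub_nonneg.2 hkj), neg_sub, zpow_sub₀ two_ne_zero]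
    simp only [mul_comm (ψ _)]
    exact hψ.enorm_integral_mul_bump_le hα hk hj hχ

lemma mem_closedBall_of_integral_mul_bump_ne_zero (hψ : IsBump α x (2 ^ k) ψ)
    {i : DyadicIndex n} {y z : 𝔼} {χ : 𝔼 → 𝕜} (hχ : IsBump α y (2 ^ i.1) χ) (hy : y ∈ cube i)
    (hz : z ∈ cube i) (hne : ∫ w, ψ w * χ w ≠ 0) :
    z ∈ closedBall x ((2 + √n) * 2 ^ max k i.1) := by
  have hyx : dist y x ≤ 2 ^ i.1 + 2 ^ k :=
    not_lt.1 fun hlt => hne (hχ.integral_mul_bump_eq_zero hψ hlt)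
  have hk : (2 : ℝ) ^ k ≤ 2 ^ max k i.1 := zpow_le_zpow_right₀ one_le_two (le_max_left _ _)
  have hi : (2 : ℝ) ^ i.1 ≤ 2 ^ max k i.1 := zpow_le_zpow_right₀ one_le_two (le_max_right _ _)
  calc dist z x ≤ dist z y + dist y x := dist_triangle _ _ _
    _ ≤ √n * 2 ^ i.1 + (2 ^ i.1 + 2 ^ k) := add_le_add (dist_le_of_mem_cube hz hy) hyx
    _ ≤ √n * 2 ^ max k i.1 + (2 ^ max k i.1 + 2 ^ max k i.1) := by gcongr
    _ = (2 + √n) * 2 ^ max k i.1 := by ring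

variable {y : DyadicIndex n → EuclideanSpace ℝ (Fin n)}
  {χ : DyadicIndex n → EuclideanSpace ℝ (Fin n) → 𝕜}

lemma tsum_volume_cube_mul_enorm_integral_le_scaleDecay (hα : 0 < α) (hψ : IsBump α x (2 ^ k) ψ)
    (hy : ∀ i, y i ∈ cube i) (hχ : ∀ i, IsBump α (y i) (2 ^ i.1) (χ i)) (j : ℤ) :
    ∑' m, volume (cube (j, m)) * ‖∫ z, ψ z * χ (j, m) z‖ₑ ≤
      scaleDecay α (j - k) * (ENNReal.ofReal (2 ^ α) * unitBallVolume n *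
        (ENNReal.ofReal ((2 + √n) ^ n) * unitBallVolume n)) := by
  set B : Set 𝔼 := closedBall x ((2 + √n) * 2 ^ max k j)
  set V : ℝ≥0∞ := ENNReal.ofReal (2 ^ α) * unitBallVolume n
  set c : ℝ≥0∞ := ENNReal.ofReal ((((2 : ℝ) ^ max k j) ^ n)⁻¹) * (scaleDecay α (j - k) * V)
  have hpoint : ∀ m, ∀ z ∈ cube (j, m),
      ‖∫ w, ψ w * χ (j, m) w‖ₑ ≤ B.indicator (fun _ => c) z := fun m z hz => by
    by_cases hzero : ∫ w, ψ w * χ (j, m) w = 0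
    · simp [hzero]
    · rw [indicator_of_mem (hψ.mem_closedBall_of_integral_mul_bump_ne_zero (hχ _) (hy _) hz hzero)]
      exact hψ.enorm_integral_mul_bump_le_scaleDecay hα (hχ (j, m))
  calc ∑' m, volume (cube (j, m)) * ‖∫ z, ψ z * χ (j, m) z‖ₑ
      = ∑' m, ∫⁻ _ in cube (j, m), ‖∫ w, ψ w * χ (j, m) w‖ₑ := by
        simp only [setLIntegral_const, mul_comm]
    _ ≤ ∑' m, ∫⁻ z in cube (j, m), B.indicator (fun _ => c) z :=
        ENNReal.tsum_le_tsum fun m => setLIntegral_mono' (measurableSet_cube _) (hpoint m)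
    _ = c * volume B := by
        rw [← lintegral_eq_tsum_cube, lintegral_indicator_const measurableSet_closedBall]
    _ = ENNReal.ofReal ((((2 : ℝ) ^ max k j) ^ n)⁻¹ * ((2 + √n) * 2 ^ max k j) ^ n) *
          (scaleDecay α (j - k) * V * unitBallVolume n) := by
        rw [volume_closedBall_eq x (by positivity), ENNReal.ofReal_mul (by positivity)]
        ring
    _ = scaleDecay α (j - k) * (V * (ENNReal.ofReal ((2 + √n) ^ n) * unitBallVolume n)) := by
        rw [mul_pow, mul_comm ((2 + √n) ^ n), inv_mul_cancel_left₀ (by positivity)]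
        ring

end IsBump

lemma exists_tsum_volume_cube_mul_enorm_integral_le (n : ℕ) (𝕜 : Type*) [RCLike 𝕜] (hα : 0 < α) :
    ∃ C : ℝ≥0, ∀ {k : ℤ} {x : EuclideanSpace ℝ (Fin n)} {ψ : EuclideanSpace ℝ (Fin n) → 𝕜},
      IsBump α x (2 ^ k) ψ → ∀ {y : DyadicIndex n → EuclideanSpace ℝ (Fin n)}
      {χ : DyadicIndex n → EuclideanSpace ℝ (Fin n) → 𝕜}, (∀ i, y i ∈ cube i) →
      (∀ i, IsBump α (y i) (2 ^ i.1) (χ i)) →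
      ∑' i, volume (cube i) * ‖∫ z, ψ z * χ i z‖ₑ ≤ C := by
  set K : ℝ≥0∞ := (∑' d : ℤ, scaleDecay α d) * (ENNReal.ofReal (2 ^ α) * unitBallVolume n *
    (ENNReal.ofReal ((2 + √n) ^ n) * unitBallVolume n))
  have hK : K ≠ ∞ := by finiteness [tsum_scaleDecay_ne_top hα, unitBallVolume_ne_top (n := n)]
  refine ⟨K.toNNReal, fun {k} x ψ hψ y χ hy hχ => ?_⟩
  rw [ENNReal.coe_toNNReal hK, ENNReal.tsum_prod']
  simp only [K]
  rw [← (Equiv.subRight k).tsum_eq (scaleDecay α), ← ENNReal.tsum_mul_right]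
  exact ENNReal.tsum_le_tsum fun j =>
    hψ.tsum_volume_cube_mul_enorm_integral_le_scaleDecay hα hy hχ j

lemma intrinsicA_le_lintegral (hα : 0 < α) (f : 𝔼 → 𝕜) (x : 𝔼) {t : ℝ} (ht : 0 < t) :
    intrinsicA α f x t ≤
      ENNReal.ofReal (2 ^ α * (t ^ n)⁻¹) * ∫⁻ z in closedBall x t, ‖f z‖ₑ :=
  iSup₂_le fun _ hφ => (hφ.isBump x ht).enorm_integral_mul_le hα ht f

lemma iSup_intrinsicA_ne_top (hα : 0 < α) {f : 𝔼 → 𝕜} (hf : LocallyIntegrable f) {S : Set 𝔼}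
    (hS : Bornology.IsBounded S) {t : ℝ} (ht : 0 < t) : ⨆ x ∈ S, intrinsicA α f x t ≠ ∞ := by
  have hfin : ∫⁻ z in cthickening t S, ‖f z‖ₑ ≠ ∞ :=
    (hf.integrableOn_isCompact <|
      isCompact_of_isClosed_isBounded isClosed_cthickening hS.cthickening).2.ne
  refine ne_top_of_le_ne_top (b := ENNReal.ofReal (2 ^ α * (t ^ n)⁻¹) * _)
    (ENNReal.mul_ne_top ENNReal.ofReal_ne_top hfin)
    (iSup₂_le fun x hx => (intrinsicA_le_lintegral hα f x ht).trans ?_)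
  gcongr
  exact closedBall_subset_cthickening hx t

lemma exists_isKernel_iSup_intrinsicA_le (hα : 0 < α) {f : 𝔼 → 𝕜} (hf : LocallyIntegrable f)
    {S : Set 𝔼} (hS : Bornology.IsBounded S) (hne : S.Nonempty) {t : ℝ} (ht : 0 < t) :
    ∃ x ∈ S, ∃ φ : 𝔼 → 𝕜, IsKernel α φ ∧
      ⨆ y ∈ S, intrinsicA α f y t ≤ 2 * ‖∫ z, dilate t φ (x - z) * f z‖ₑ := by
  rcases eq_or_ne (⨆ y ∈ S, intrinsicA α f y t) 0 with hzero | hzero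
  · obtain ⟨x, hx⟩ := hne
    exact ⟨x, hx, 0, .zero, hzero.trans_le zero_le⟩
  · have hlt := ENNReal.half_lt_self hzero (iSup_intrinsicA_ne_top hα hf hS ht)
    conv_rhs at hlt => simp only [intrinsicA]
    simp only [lt_iSup_iff] at hlt
    obtain ⟨x, hx, φ, hφ, hlt⟩ := hlt
    exact ⟨x, hx, φ, hφ,
      (ENNReal.div_le_iff' two_ne_zero ENNReal.ofNat_ne_top).1 hlt.le⟩

lemma exists_tsum_volume_cube_mul_iSup_intrinsicA_sq_le (n : ℕ) (𝕜 : Type*) [RCLike 𝕜]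
    (hα : 0 < α) : ∃ C : ℝ≥0, ∀ f : EuclideanSpace ℝ (Fin n) → 𝕜, MemLp f 2 →
      ∑' i : DyadicIndex n, volume (cube i) * (⨆ x ∈ cube i, intrinsicA α f x (2 ^ i.1)) ^ 2 ≤
        C * ∫⁻ z, ‖f z‖ₑ ^ 2 := by
  obtain ⟨C, hC⟩ := exists_tsum_volume_cube_mul_enorm_integral_le n 𝕜 hα
  refine ⟨2 ^ 2 * C, fun f hf => ?_⟩
  have hscale : ∀ i : DyadicIndex n, (0 : ℝ) < 2 ^ i.1 := fun i => by positivity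
  choose y hy φ hφ hsup using fun i : DyadicIndex n => exists_isKernel_iSup_intrinsicA_le hα
    (hf.locallyIntegrable one_le_two) (isBounded_closedBall.subset
      (cube_subset_closedBall (corner_mem_cube i))) ⟨_, corner_mem_cube i⟩ (hscale i)
  set χ : DyadicIndex n → EuclideanSpace ℝ (Fin n) → 𝕜 :=
    fun i z => dilate (2 ^ i.1) (φ i) (y i - z)
  have hχ : ∀ i, IsBump α (y i) (2 ^ i.1) (χ i) := fun i => (hφ i).isBump (y i) (hscale i)
  rw [ENNReal.tsum_eq_iSup_sum]
  refine iSup_le fun s => ?_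
  calc ∑ i ∈ s, volume (cube i) * (⨆ x ∈ cube i, intrinsicA α f x (2 ^ i.1)) ^ 2
      ≤ ∑ i ∈ s, volume (cube i) * (2 * ‖∫ z, χ i z * f z‖ₑ) ^ 2 := by
        gcongr with i
        exact hsup i
    _ = 2 ^ 2 * ∑ i ∈ s, (volume (cube i)).toNNReal * ‖∫ z, χ i z * f z‖ₑ ^ 2 := by
        simp only [mul_pow, mul_left_comm _ ((2 : ℝ≥0∞) ^ 2), Finset.mul_sum,
          ENNReal.coe_toNNReal (volume_cube_ne_top _)]
    _ ≤ 2 ^ 2 * (C * ∫⁻ z, ‖f z‖ₑ ^ 2) := by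
        gcongr
        refine sum_mul_enorm_integral_mul_sq_le (fun i => ((hχ i).conj.continuous hα)
          |>.memLp_of_hasCompactSupport (hχ i).conj.hasCompactSupport) (fun i _ => ?_) hf
        simp only [ENNReal.coe_toNNReal (volume_cube_ne_top _)]
        exact (ENNReal.sum_le_tsum s).trans (hC (hχ i) hy fun j => (hχ j).conj)
    _ = (2 ^ 2 * C : ℝ≥0) * ∫⁻ z, ‖f z‖ₑ ^ 2 := by push_cast; ring

theorem exists_lintegral_intrinsicG_sq_le (n : ℕ) (𝕜 : Type*) [RCLike 𝕜] (hα : 0 < α) :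
    ∃ C : ℝ≥0, ∀ f : EuclideanSpace ℝ (Fin n) → 𝕜, MemLp f 2 →
      ∫⁻ x, intrinsicG α f x ^ 2 ≤ C * ∫⁻ z, ‖f z‖ₑ ^ 2 := by
  obtain ⟨C, hC⟩ := exists_tsum_volume_cube_mul_iSup_intrinsicA_sq_le n 𝕜 hα
  set c : ℝ≥0 := (2 ^ n * 2 ^ α : ℝ).toNNReal
  refine ⟨c ^ 2 * C, fun f hf => ?_⟩
  have hfl : LocallyIntegrable f := hf.locallyIntegrable one_le_two
  calc ∫⁻ x, intrinsicG α f x ^ 2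
      ≤ ∫⁻ x, ∑' k : ℤ, (c * intrinsicA α f x (2 ^ k)) ^ 2 := by
        gcongr with x
        have hx := intrinsicG_sq_le_tsum hα f x one_pos
        simp only [mul_one] at hx
        exact hx
    _ = ∑' k : ℤ, ∫⁻ x, (c * intrinsicA α f x (2 ^ k)) ^ 2 :=
        lintegral_tsum fun k => ((((measurable_intrinsicA hα hfl (by positivity)).const_mul
          _).pow_const 2).aemeasurable)
    _ = ∑' i : DyadicIndex n, ∫⁻ x in cube i, (c * intrinsicA α f x (2 ^ i.1)) ^ 2 := by
        rw [ENNReal.tsum_prod']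
        exact tsum_congr fun k => lintegral_eq_tsum_cube k _
    _ ≤ ∑' i : DyadicIndex n, c ^ 2 *
          (volume (cube i) * (⨆ x ∈ cube i, intrinsicA α f x (2 ^ i.1)) ^ 2) := by
        refine ENNReal.tsum_le_tsum fun i => ?_
        refine (setLIntegral_mono' (measurableSet_cube i)
          (g := fun _ => (c * ⨆ x ∈ cube i, intrinsicA α f x (2 ^ i.1)) ^ 2)
          fun x hx => ?_).trans_eq ?_
        · gcongr
          exact le_iSup₂ (f := fun x (_ : x ∈ cube i) => intrinsicA α f x (2 ^ i.1)) x hx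
        · rw [setLIntegral_const]
          ring
    _ ≤ (c ^ 2 * C : ℝ≥0) * ∫⁻ z, ‖f z‖ₑ ^ 2 := by
        rw [ENNReal.tsum_mul_left, ENNReal.coe_mul, ENNReal.coe_pow, mul_assoc]
        gcongr
        exact hC f hf

/-! ### The Calderón–Zygmund decomposition -/

section Averaging

variable {X ι E : Type*} [MeasurableSpace X] {μ : Measure X} [NormedAddCommGroup E]
  [NormedSpace ℝ E] {Q : ι → Set X} {S : Set ι} {f : X → E}

open Classical in
/-- The function obtained from `f` by replacing its values on each of the disjoint sets `Q i`,
`i ∈ S`, by its mean value over that set. -/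
def averageOn (μ : Measure X) (Q : ι → Set X) (S : Set ι) (f : X → E) (x : X) : E :=
  if h : ∃ i ∈ S, x ∈ Q i then ⨍ z in Q h.choose, f z ∂μ else f x

lemma averageOn_of_mem (hdisj : S.PairwiseDisjoint Q) {i : ι} (hi : i ∈ S) {x : X}
    (hx : x ∈ Q i) : averageOn μ Q S f x = ⨍ z in Q i, f z ∂μ := by
  have h : ∃ i ∈ S, x ∈ Q i := ⟨i, hi, hx⟩
  rw [averageOn, dif_pos h, hdisj.elim_set h.choose_spec.1 hi x h.choose_spec.2 hx]

lemma averageOn_of_notMem {x : X} (hx : x ∉ ⋃ i ∈ S, Q i) : averageOn μ Q S f x = f x :=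
  dif_neg fun ⟨_, hi, hxi⟩ => hx (mem_biUnion hi hxi)

lemma enorm_setAverage_mul_le [CompleteSpace E] (f : X → E) {s : Set X} (hs : μ s ≠ ∞) :
    ‖⨍ z in s, f z ∂μ‖ₑ * μ s ≤ ∫⁻ z in s, ‖f z‖ₑ ∂μ := by
  have havg := congrArg enorm (measure_smul_setAverage f hs)
  rw [enorm_smul, Real.enorm_eq_ofReal measureReal_nonneg, Measure.real,
    ENNReal.ofReal_toReal hs] at havg
  rw [mul_comm, havg]
  exact enorm_integral_le_lintegral_enorm f

lemma aestronglyMeasurable_averageOn [Countable ι] (hdisj : S.PairwiseDisjoint Q)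
    (hQ : ∀ i ∈ S, MeasurableSet (Q i)) (hf : AEStronglyMeasurable f μ) :
    AEStronglyMeasurable (averageOn μ Q S f) μ := by
  have hU : MeasurableSet (⋃ i ∈ S, Q i) := .biUnion S.to_countable hQ
  suffices h : AEStronglyMeasurable (averageOn μ Q S f)
      (μ.restrict ((⋃ i ∈ S, Q i) ∪ (⋃ i ∈ S, Q i)ᶜ)) by
    rwa [union_compl_self, Measure.restrict_univ] at h
  refine aestronglyMeasurable_union_iff.2 ⟨?_, ?_⟩
  · rw [biUnion_eq_iUnion, aestronglyMeasurable_iUnion_iff]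
    refine fun i => (aestronglyMeasurable_const (b := ⨍ z in Q i, f z ∂μ)).congr ?_
    filter_upwards [ae_restrict_mem (hQ i i.2)] with x hx
    exact (averageOn_of_mem hdisj i.2 hx).symm
  · refine hf.restrict.congr ?_
    filter_upwards [ae_restrict_mem hU.compl] with x hx
    exact (averageOn_of_notMem hx).symm

lemma lintegral_enorm_averageOn_le [CompleteSpace E] [Countable ι] (hdisj : S.PairwiseDisjoint Q)
    (hQ : ∀ i ∈ S, MeasurableSet (Q i)) (hfin : ∀ i ∈ S, μ (Q i) ≠ ∞) (f : X → E) :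
    ∫⁻ x, ‖averageOn μ Q S f x‖ₑ ∂μ ≤ ∫⁻ x, ‖f x‖ₑ ∂μ := by
  have hU : MeasurableSet (⋃ i ∈ S, Q i) := .biUnion S.to_countable hQ
  rw [← lintegral_add_compl _ hU, ← lintegral_add_compl (fun x => ‖f x‖ₑ) hU,
    lintegral_biUnion S.to_countable hQ hdisj, lintegral_biUnion S.to_countable hQ hdisj]
  refine add_le_add (ENNReal.tsum_le_tsum fun i => ?_) (le_of_eq ?_)
  · rw [setLIntegral_congr_fun (hQ i i.2) fun x hx => congrArg enorm
      (averageOn_of_mem hdisj i.2 hx), setLIntegral_const]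
    exact enorm_setAverage_mul_le f (hfin i i.2)
  · exact setLIntegral_congr_fun hU.compl fun x hx => by rw [averageOn_of_notMem hx]

lemma setIntegral_sub_averageOn [CompleteSpace E] (hdisj : S.PairwiseDisjoint Q) {i : ι}
    (hi : i ∈ S) (hQ : MeasurableSet (Q i)) (hfin : μ (Q i) ≠ ∞) (hf : IntegrableOn f (Q i) μ) :
    ∫ x in Q i, (f x - averageOn μ Q S f x) ∂μ = 0 := by
  rw [setIntegral_congr_fun hQ fun x hx => by rw [averageOn_of_mem hdisj hi hx],
    integral_sub hf (integrableOn_const hfin), setIntegral_const, measure_smul_setAverage f hfin,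
    sub_self]

end Averaging

/-- The dyadic cube is heavy for `f` at level `l` if the mean of `‖f‖` over it exceeds `l`. -/
def IsHeavy (f : 𝔼 → 𝕜) (l : ℝ≥0∞) (i : DyadicIndex n) : Prop :=
  l * volume (cube i) < ∫⁻ z in cube i, ‖f z‖ₑ

/-- The heavy dyadic cubes none of whose strict ancestors is heavy. -/
def stoppingCubes (f : 𝔼 → 𝕜) (l : ℝ≥0∞) : Set (DyadicIndex n) :=
  {i | IsHeavy f l i ∧ ∀ j, i.1 < j → ¬ IsHeavy f l (cubeAt j (corner i))}

lemma cube_subset_cubeAt {i : DyadicIndex n} {j : ℤ} (hij : i.1 ≤ j) {x : 𝔼} (hx : x ∈ cube i) :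
    cube i ⊆ cube (cubeAt j x) :=
  fun _ hz => cubeAt_eq_of_le hij (Eq.trans hz hx.symm)

lemma fst_le_of_mem_stoppingCubes {f : 𝔼 → 𝕜} {l : ℝ≥0∞} {i j : DyadicIndex n}
    (hi : i ∈ stoppingCubes f l) (hj : j ∈ stoppingCubes f l) {z : 𝔼} (hzi : z ∈ cube i)
    (hzj : z ∈ cube j) : j.1 ≤ i.1 := by
  by_contra! hlt
  have hcorner : cubeAt j.1 (corner i) = j :=
    (cubeAt_eq_of_le hlt.le ((corner_mem_cube i).trans hzi.symm)).trans hzj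
  exact hi.2 j.1 hlt (hcorner ▸ hj.1)

lemma pairwiseDisjoint_stoppingCubes (f : 𝔼 → 𝕜) (l : ℝ≥0∞) :
    (stoppingCubes f l).PairwiseDisjoint cube := by
  refine fun i hi j hj hne => disjoint_left.2 fun z hzi hzj => ?_
  have hscale : i.1 = j.1 :=
    le_antisymm (fst_le_of_mem_stoppingCubes hj hi hzj hzi)
      (fst_le_of_mem_stoppingCubes hi hj hzi hzj)
  exact disjoint_left.1 (disjoint_cube hscale hne) hzi hzj

lemma exists_le_of_isHeavy [NeZero n] {f : 𝔼 → 𝕜} (hf : Integrable f) {l : ℝ≥0∞} (hl : l ≠ 0) :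
    ∃ b : ℤ, ∀ i : DyadicIndex n, IsHeavy f l i → i.1 ≤ b := by
  obtain ⟨b, hb⟩ := ENNReal.exists_nat_gt (ENNReal.div_ne_top hf.2.ne hl)
  refine ⟨b, fun i hi => ?_⟩
  by_contra! hlt
  have hside : (b : ℝ) ≤ ((2 : ℝ) ^ i.1) ^ n :=
    calc (b : ℝ) ≤ 2 ^ b := by exact_mod_cast b.lt_two_pow_self.le
      _ ≤ 2 ^ i.1 := by
          rw [← zpow_natCast]
          exact zpow_le_zpow_right₀ one_le_two hlt.le
      _ ≤ (2 ^ i.1) ^ n := le_self_pow₀ (one_le_zpow₀ one_le_two (by lia)) (NeZero.ne n)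
  have hvol : (b : ℝ≥0∞) ≤ volume (cube i) := by
    rw [volume_cube, ← ENNReal.ofReal_natCast]
    exact ENNReal.ofReal_le_ofReal hside
  have hlarge : ∫⁻ z, ‖f z‖ₑ ≤ l * volume (cube i) := by
    rw [mul_comm]
    exact (ENNReal.div_le_iff_le_mul (.inl hl) (.inr (volume_cube_ne_zero i))).1
      (hb.le.trans hvol)
  exact absurd (hi.trans_le (setLIntegral_le_lintegral _ _)) hlarge.not_gt

lemma exists_mem_stoppingCubes [NeZero n] {f : 𝔼 → 𝕜} (hf : Integrable f) {l : ℝ≥0∞}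
    (hl : l ≠ 0) {x : 𝔼} {k : ℤ} (hk : IsHeavy f l (cubeAt k x)) :
    ∃ i ∈ stoppingCubes f l, x ∈ cube i := by
  obtain ⟨b, hb⟩ := exists_le_of_isHeavy hf hl
  obtain ⟨j, hj, hmax⟩ := Int.exists_greatest_of_bdd
    (P := fun j => IsHeavy f l (cubeAt j x)) ⟨b, fun j hj => hb _ hj⟩ ⟨k, hk⟩
  refine ⟨cubeAt j x, ⟨hj, fun j' hlt hheavy => (hmax j' ?_).not_gt hlt⟩, mem_cube_cubeAt j x⟩
  rwa [cubeAt_eq_of_le hlt.le (corner_mem_cube (cubeAt j x))] at hheavy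

lemma lintegral_le_of_mem_stoppingCubes {f : 𝔼 → 𝕜} {l : ℝ≥0∞} {i : DyadicIndex n}
    (hi : i ∈ stoppingCubes f l) : ∫⁻ z in cube i, ‖f z‖ₑ ≤ 2 ^ n * l * volume (cube i) := by
  set parent := cubeAt (i.1 + 1) (corner i)
  have hvol : volume (cube parent) = 2 ^ n * volume (cube i) := by
    rw [volume_cube, volume_cube, ← ENNReal.ofReal_ofNat, ← ENNReal.ofReal_pow (by positivity),
      ← ENNReal.ofReal_mul (by positivity), ← mul_pow, mul_comm, ← zpow_add_one₀ two_ne_zero]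
    rfl
  calc ∫⁻ z in cube i, ‖f z‖ₑ ≤ ∫⁻ z in cube parent, ‖f z‖ₑ :=
        lintegral_mono_set (cube_subset_cubeAt (by lia) (corner_mem_cube i))
    _ ≤ l * volume (cube parent) := not_lt.1 (hi.2 (i.1 + 1) (by lia))
    _ = 2 ^ n * l * volume (cube i) := by rw [hvol]; ring

lemma enorm_le_of_not_isHeavy {f : 𝔼 → 𝕜} (hf : AEStronglyMeasurable f) {l : ℝ≥0∞} {x : 𝔼}
    {k : ℤ} (hlight : ¬ IsHeavy f l (cubeAt k x)) :
    ‖f x‖ₑ ≤ l + ENNReal.ofReal ((√n + 1) ^ n) * unitBallVolume n *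
      ((∫⁻ y in closedBall x ((√n + 1) * 2 ^ k), ‖f y - f x‖ₑ) /
        volume (closedBall x ((√n + 1) * 2 ^ k))) := by
  set Q := cube (cubeAt k x)
  set B := closedBall x ((√n + 1) * 2 ^ k)
  have hsub : Q ⊆ B := (cube_subset_closedBall (mem_cube_cubeAt k x)).trans
    (closedBall_subset_closedBall (mul_le_mul_of_nonneg_right (by simp) (by positivity)))
  have hB : volume B = ENNReal.ofReal ((√n + 1) ^ n) * unitBallVolume n * volume Q :=
    volume_closedBall_eq_mul_volume_cube x (by positivity) (cubeAt k x)
  have hQB : (∫⁻ y in B, ‖f y - f x‖ₑ) = ENNReal.ofReal ((√n + 1) ^ n) * unitBallVolume n *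
      ((∫⁻ y in B, ‖f y - f x‖ₑ) / volume B) * volume Q := by
    rw [mul_right_comm, ← hB, ENNReal.mul_div_cancel
      (measure_closedBall_pos volume x (by positivity)).ne' measure_closedBall_lt_top.ne]
  rw [← ENNReal.mul_le_mul_iff_left (volume_cube_ne_zero (cubeAt k x))
    (volume_cube_ne_top (cubeAt k x)), add_mul, ← hQB]
  calc ‖f x‖ₑ * volume Q = ∫⁻ _ in Q, ‖f x‖ₑ := by rw [setLIntegral_const]
    _ ≤ ∫⁻ y in Q, (‖f y‖ₑ + ‖f y - f x‖ₑ) := by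
        refine lintegral_mono fun y => ?_
        simpa using enorm_sub_le (a := f y) (b := f y - f x)
    _ = (∫⁻ y in Q, ‖f y‖ₑ) + ∫⁻ y in Q, ‖f y - f x‖ₑ :=
        lintegral_add_left' hf.restrict.enorm _
    _ ≤ l * volume Q + ∫⁻ y in B, ‖f y - f x‖ₑ :=
        add_le_add (not_lt.1 hlight) (lintegral_mono_set hsub)

lemma tendsto_mul_two_zpow_neg {c : ℝ} (hc : 0 < c) :
    Tendsto (fun j : ℕ => c * (2 : ℝ) ^ (-(j : ℤ))) atTop (𝓝[>] 0) := by
  refine tendsto_nhdsWithin_iff.2 ⟨?_, Eventually.of_forall fun j => mul_pos hc (by positivity)⟩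
  have hpow : Tendsto (fun j : ℕ => ((2 : ℝ)⁻¹) ^ j) atTop (𝓝 0) :=
    tendsto_pow_atTop_nhds_zero_of_lt_one (by norm_num) (by norm_num)
  simpa using hpow.const_mul c

lemma ae_enorm_le_of_forall_not_isHeavy {f : 𝔼 → 𝕜} (hf : LocallyIntegrable f) (l : ℝ≥0∞) :
    ∀ᵐ x, (∀ k, ¬ IsHeavy f l (cubeAt k x)) → ‖f x‖ₑ ≤ l := by
  filter_upwards [(IsUnifLocDoublingMeasure.vitaliFamily (volume : Measure 𝔼) 1
    ).ae_tendsto_lintegral_enorm_sub_div hf] with x hx hlight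
  set δ : ℕ → ℝ := fun j => (√n + 1) * 2 ^ (-(j : ℤ))
  have hballs := IsUnifLocDoublingMeasure.tendsto_closedBall_filterAt (volume : Measure 𝔼)
    (K := 1) (x := x) (fun _ => x) δ (tendsto_mul_two_zpow_neg (by positivity))
    (Eventually.of_forall fun j => mem_closedBall_self (by positivity))
  have hc : ENNReal.ofReal ((√n + 1) ^ n) * unitBallVolume n ≠ ∞ := by
    finiteness [unitBallVolume_ne_top (n := n)]
  have hlim := (ENNReal.Tendsto.const_mul (hx.comp hballs) (.inr hc)).const_add l
  rw [mul_zero, add_zero] at hlim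
  exact ge_of_tendsto' hlim fun j => enorm_le_of_not_isHeavy hf.aestronglyMeasurable (hlight _)

/-- The Calderón–Zygmund decomposition of `f` at level `l`: the good part `g`, and the family `S`
of disjoint dyadic cubes which carries the bad part `f - g`. -/
structure IsCalderonZygmund (f g : 𝔼 → 𝕜) (l : ℝ≥0∞) (S : Set (DyadicIndex n)) : Prop where
  pairwiseDisjoint : S.PairwiseDisjoint cube
  integrable : Integrable g
  enorm_le : ∀ᵐ x, ‖g x‖ₑ ≤ 2 ^ n * l
  lintegral_le : ∫⁻ x, ‖g x‖ₑ ≤ ∫⁻ x, ‖f x‖ₑ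
  eq_off : ∀ x ∉ ⋃ i ∈ S, cube i, g x = f x
  setIntegral_eq_zero : ∀ i ∈ S, ∫ x in cube i, (f x - g x) = 0
  mul_volume_le : ∀ i ∈ S, l * volume (cube i) ≤ ∫⁻ x in cube i, ‖f x‖ₑ

theorem exists_isCalderonZygmund [NeZero n] {f : 𝔼 → 𝕜} (hf : Integrable f) {l : ℝ≥0∞}
    (hl : l ≠ 0) : ∃ g S, IsCalderonZygmund f g l S := by
  set S := stoppingCubes f l
  have hdisj : S.PairwiseDisjoint cube := pairwiseDisjoint_stoppingCubes f l
  have hle := lintegral_enorm_averageOn_le hdisj (fun i _ => measurableSet_cube i)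
    (fun i _ => volume_cube_ne_top i) f
  refine ⟨averageOn volume cube S f, S, hdisj, ⟨aestronglyMeasurable_averageOn hdisj
    (fun i _ => measurableSet_cube i) hf.1, hle.trans_lt hf.2⟩, ?_, hle,
    fun x hx => averageOn_of_notMem hx, fun i hi => setIntegral_sub_averageOn hdisj hi
      (measurableSet_cube i) (volume_cube_ne_top i) hf.integrableOn, fun i hi => hi.1.le⟩
  filter_upwards [ae_enorm_le_of_forall_not_isHeavy hf.locallyIntegrable l] with x hx
  by_cases hmem : x ∈ ⋃ i ∈ S, cube i
  · obtain ⟨i, hi, hxi⟩ := mem_iUnion₂.1 hmem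
    rw [averageOn_of_mem hdisj hi hxi, ← ENNReal.mul_le_mul_iff_left (volume_cube_ne_zero i)
      (volume_cube_ne_top i)]
    exact (enorm_setAverage_mul_le f (volume_cube_ne_top i)).trans
      (lintegral_le_of_mem_stoppingCubes hi)
  · rw [averageOn_of_notMem hmem]
    refine (hx fun k hk => hmem ?_).trans (le_mul_of_one_le_left' (one_le_pow₀ one_le_two))
    obtain ⟨i, hi, hxi⟩ := exists_mem_stoppingCubes hf hl hk
    exact mem_biUnion hi hxi

/-! ### The weak type (1,1) estimate -/

/-- The ball about a dyadic cube, outside of which an atom carried by the cube is only seen by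
bumps at scales larger than the side of the cube. -/
def cubeBall (i : DyadicIndex n) : Set 𝔼 :=
  closedBall (corner i) ((√n + 1) * 2 ^ i.1)

lemma lt_and_mem_closedBall_of_notMem_cubeBall {i : DyadicIndex n} {k : ℤ} {x z : 𝔼}
    (hx : x ∉ cubeBall i) (hz : z ∈ cube i) (hzx : z ∈ closedBall x (2 ^ k)) :
    i.1 < k ∧ x ∈ closedBall (corner i) ((√n + 1) * 2 ^ k) := by
  have hdist : dist x (corner i) ≤ √n * 2 ^ i.1 + 2 ^ k := by
    linarith [dist_triangle_left x (corner i) z, mem_closedBall.1 hzx,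
      dist_le_of_mem_cube hz (corner_mem_cube i)]
  rw [cubeBall, mem_closedBall, not_le] at hx
  have hlt : (2 : ℝ) ^ i.1 < 2 ^ k := by linarith
  have hle : √n * (2 : ℝ) ^ i.1 ≤ √n * 2 ^ k := by gcongr
  exact ⟨(zpow_lt_zpow_iff_right₀ one_lt_two).1 hlt, mem_closedBall.2 (by linarith)⟩

lemma integral_mul_indicator {X : Type*} [MeasurableSpace X] {μ : Measure X} {s : Set X}
    (hs : MeasurableSet s) (ψ f : X → 𝕜) :
    ∫ z, ψ z * s.indicator f z ∂μ = ∫ z in s, ψ z * f z ∂μ := by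
  simp only [← integral_indicator hs, indicator_mul_right]

lemma intrinsicA_indicator_le {f : 𝔼 → 𝕜} {s : Set 𝔼} (hs : MeasurableSet s) {x : 𝔼} {t : ℝ}
    (ht : 0 < t) {M : ℝ≥0∞}
    (hM : ∀ ψ : 𝔼 → 𝕜, IsBump α x t ψ → ‖∫ z in s, ψ z * f z‖ₑ ≤ M) :
    intrinsicA α (s.indicator f) x t ≤ M := by
  refine iSup₂_le fun φ hφ => ?_
  rw [integral_mul_indicator hs fun z => dilate t φ (x - z)]
  exact hM _ (hφ.isBump x ht)

lemma intrinsicA_indicator_cube_le (hα : 0 < α) {b : 𝔼 → 𝕜} {i : DyadicIndex n}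
    (hb : IntegrableOn b (cube i)) (hmean : ∫ z in cube i, b z = 0) (k : ℤ) {x : 𝔼}
    (hx : x ∉ cubeBall i) :
    intrinsicA α ((cube i).indicator b) x (2 ^ k) ≤
      (closedBall (corner i) ((√n + 1) * 2 ^ k)).indicator
        (fun _ => ENNReal.ofReal (((2 ^ k) ^ n)⁻¹ * √n ^ α) * scaleDecay α (k - i.1) *
          ∫⁻ z in cube i, ‖b z‖ₑ) x := by
  refine intrinsicA_indicator_le (measurableSet_cube i) (by positivity) fun ψ hψ => ?_
  by_cases hmeet : ∃ z ∈ cube i, z ∈ closedBall x (2 ^ k)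
  · obtain ⟨z, hz, hzx⟩ := hmeet
    obtain ⟨hscale, hmem⟩ := lt_and_mem_closedBall_of_notMem_cubeBall hx hz hzx
    have hratio : √n * 2 ^ i.1 / 2 ^ k = √n * (2 : ℝ) ^ (-|k - i.1|) := by
      rw [abs_of_pos (sub_pos.2 hscale), neg_sub, zpow_sub₀ two_ne_zero, mul_div_assoc]
    have hle := hψ.enorm_setIntegral_mul_le hα (by positivity) (measurableSet_cube i) hb hmean
      fun w hw => dist_le_of_mem_cube hw (corner_mem_cube i)
    rwa [hratio, Real.mul_rpow (by positivity) (by positivity), ← mul_assoc,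
      ENNReal.ofReal_mul (by positivity), ← indicator_of_mem hmem fun _ : 𝔼 => _ * _] at hle
  · rw [setIntegral_eq_zero_of_forall_eq_zero fun z hz => by
      rw [hψ.eq_zero z fun hzx => hmeet ⟨z, hz, hzx⟩, zero_mul], enorm_zero]
    exact zero_le

lemma lintegral_compl_cubeBall_intrinsicA_le (hα : 0 < α) {b : 𝔼 → 𝕜} {i : DyadicIndex n}
    (hb : IntegrableOn b (cube i)) (hmean : ∫ z in cube i, b z = 0) (k : ℤ) :
    ∫⁻ x in (cubeBall i)ᶜ, intrinsicA α ((cube i).indicator b) x (2 ^ k) ≤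
      ENNReal.ofReal (√n ^ α * (√n + 1) ^ n) * unitBallVolume n * scaleDecay α (k - i.1) *
        ∫⁻ z in cube i, ‖b z‖ₑ := by
  refine (setLIntegral_mono' measurableSet_closedBall.compl fun x hx =>
    intrinsicA_indicator_cube_le hα hb hmean k hx).trans ?_
  refine (setLIntegral_le_lintegral _ _).trans (le_of_eq ?_)
  have hscale : (((2 : ℝ) ^ k) ^ n)⁻¹ * √n ^ α * ((√n + 1) * 2 ^ k) ^ n =
      √n ^ α * (√n + 1) ^ n := by
    rw [mul_pow]
    field_simp
  rw [lintegral_indicator_const measurableSet_closedBall, volume_closedBall_eq _ (by positivity),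
    ← hscale, ENNReal.ofReal_mul (q := ((√n + 1) * 2 ^ k) ^ n) (by positivity)]
  ring

lemma exists_lintegral_compl_cubeBall_tsum_intrinsicA_le (n : ℕ) (𝕜 : Type*) [RCLike 𝕜]
    (hα : 0 < α) :
    ∃ C : ℝ≥0, ∀ (b : EuclideanSpace ℝ (Fin n) → 𝕜) (i : DyadicIndex n),
      IntegrableOn b (cube i) → ∫ z in cube i, b z = 0 →
        ∫⁻ x in (cubeBall i)ᶜ, ∑' k : ℤ, intrinsicA α ((cube i).indicator b) x (2 ^ k) ≤
          C * ∫⁻ z in cube i, ‖b z‖ₑ := by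
  set c : ℝ≥0∞ := ENNReal.ofReal (√n ^ α * (√n + 1) ^ n) * unitBallVolume n
  have hc : c ≠ ∞ := by finiteness [unitBallVolume_ne_top (n := n)]
  refine ⟨(c * ∑' d, scaleDecay α d).toNNReal, fun b i hb hmean => ?_⟩
  rw [ENNReal.coe_toNNReal (ENNReal.mul_ne_top hc (tsum_scaleDecay_ne_top hα)), lintegral_tsum
    fun k => (measurable_intrinsicA hα (hb.integrable_indicator
      (measurableSet_cube i)).locallyIntegrable (by positivity)).aemeasurable]
  refine (ENNReal.tsum_le_tsum fun k =>
    lintegral_compl_cubeBall_intrinsicA_le hα hb hmean k).trans (le_of_eq ?_)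
  have hshift : ∑' k : ℤ, scaleDecay α (k - i.1) = ∑' d : ℤ, scaleDecay α d :=
    (Equiv.subRight i.1).tsum_eq (scaleDecay α)
  rw [ENNReal.tsum_mul_right, ENNReal.tsum_mul_left, hshift]

lemma intrinsicA_le_tsum_indicator {ι : Type*} [Countable ι] (hα : 0 < α) {b : 𝔼 → 𝕜}
    (hb : LocallyIntegrable b) {Q : ι → Set 𝔼} (hQ : ∀ i, MeasurableSet (Q i)) {S : Set ι}
    (hdisj : S.PairwiseDisjoint Q) (hoff : ∀ z ∉ ⋃ i ∈ S, Q i, b z = 0) (x : 𝔼) {t : ℝ}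
    (ht : 0 < t) : intrinsicA α b x t ≤ ∑' i : S, intrinsicA α ((Q i).indicator b) x t := by
  refine iSup₂_le fun φ hφ => ?_
  have hint := (hφ.isBump x ht).integrable_mul hα hb
  have hsplit : ∫ z, dilate t φ (x - z) * b z =
      ∑' i : S, ∫ z, dilate t φ (x - z) * (Q i).indicator b z := by
    simp only [integral_mul_indicator (hQ _) fun z => dilate t φ (x - z)]
    rw [← integral_iUnion (fun i : S => hQ i)
      (fun i j hij => hdisj i.2 j.2 (Subtype.coe_injective.ne hij)) hint.integrableOn,
      ← biUnion_eq_iUnion S fun i _ => Q i]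
    exact (setIntegral_eq_integral_of_forall_compl_eq_zero fun z hz => by
      rw [hoff z hz, mul_zero]).symm
  rw [hsplit]
  exact enorm_tsum_le_tsum_enorm.trans (ENNReal.tsum_le_tsum fun i =>
    hφ.enorm_integral_le_intrinsicA ((Q i).indicator b) x t)

theorem exists_lintegral_compl_iUnion_cubeBall_intrinsicG_le (n : ℕ) (𝕜 : Type*) [RCLike 𝕜]
    (hα : 0 < α) :
    ∃ C : ℝ≥0, ∀ (b : EuclideanSpace ℝ (Fin n) → 𝕜) (S : Set (DyadicIndex n)), Integrable b →
      S.PairwiseDisjoint cube → (∀ z ∉ ⋃ i ∈ S, cube i, b z = 0) →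
      (∀ i ∈ S, ∫ z in cube i, b z = 0) →
        ∫⁻ x in (⋃ i ∈ S, cubeBall i)ᶜ, intrinsicG α b x ≤ C * ∫⁻ z, ‖b z‖ₑ := by
  obtain ⟨C, hC⟩ := exists_lintegral_compl_cubeBall_tsum_intrinsicA_le n 𝕜 hα
  set c : ℝ≥0 := (2 ^ n * 2 ^ α : ℝ).toNNReal
  refine ⟨c * C, fun b S hb hdisj hoff hmean => ?_⟩
  have hpoint : ∀ x, intrinsicG α b x ≤
      c * ∑' i : S, ∑' k : ℤ, intrinsicA α ((cube i.1).indicator b) x (2 ^ k) := fun x => by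
    rw [ENNReal.tsum_comm]
    refine (intrinsicG_le_tsum hα b x one_pos).trans (mul_le_mul_right ?_ _)
    simp only [mul_one]
    exact ENNReal.tsum_le_tsum fun k => intrinsicA_le_tsum_indicator hα hb.locallyIntegrable
      measurableSet_cube hdisj hoff x (by positivity)
  have hmeas : ∀ i : S, Measurable fun x =>
      ∑' k : ℤ, intrinsicA α ((cube i.1).indicator b) x (2 ^ k) := fun i =>
    .tsum fun k => measurable_intrinsicA hα
      (hb.indicator (measurableSet_cube i.1)).locallyIntegrable (by positivity)
  calc ∫⁻ x in (⋃ i ∈ S, cubeBall i)ᶜ, intrinsicG α b x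
      ≤ c * ∑' i : S, ∫⁻ x in (⋃ i ∈ S, cubeBall i)ᶜ,
          ∑' k : ℤ, intrinsicA α ((cube i.1).indicator b) x (2 ^ k) := by
        rw [← lintegral_tsum fun i => (hmeas i).aemeasurable,
          ← lintegral_const_mul' _ _ ENNReal.coe_ne_top]
        exact lintegral_mono hpoint
    _ ≤ c * ∑' i : S, C * ∫⁻ z in cube i.1, ‖b z‖ₑ := by
        gcongr with i
        exact (lintegral_mono_set (compl_subset_compl.2 (subset_biUnion_of_mem i.2))).trans
          (hC b i hb.integrableOn (hmean i i.2))
    _ ≤ (c * C : ℝ≥0) * ∫⁻ z, ‖b z‖ₑ := by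
        rw [ENNReal.tsum_mul_left, ENNReal.coe_mul, mul_assoc, ← lintegral_biUnion
          S.to_countable (fun i _ => measurableSet_cube i) hdisj]
        gcongr
        exact Measure.restrict_le_self

namespace IsCalderonZygmund

variable {f g : EuclideanSpace ℝ (Fin n) → 𝕜} {l : ℝ≥0∞} {S : Set (DyadicIndex n)}

lemma lintegral_sq_le (h : IsCalderonZygmund f g l S) :
    ∫⁻ x, ‖g x‖ₑ ^ 2 ≤ l * (2 ^ n * ∫⁻ x, ‖f x‖ₑ) :=
  calc ∫⁻ x, ‖g x‖ₑ ^ 2 ≤ ∫⁻ x, 2 ^ n * l * ‖g x‖ₑ := by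
        refine lintegral_mono_ae (h.enorm_le.mono fun x hx => ?_)
        rw [sq]
        gcongr
    _ = 2 ^ n * l * ∫⁻ x, ‖g x‖ₑ := lintegral_const_mul'' _ h.integrable.1.enorm
    _ ≤ 2 ^ n * l * ∫⁻ x, ‖f x‖ₑ := by grw [h.lintegral_le]
    _ = l * (2 ^ n * ∫⁻ x, ‖f x‖ₑ) := by ring

lemma memLp_two (h : IsCalderonZygmund f g l S) (hf : Integrable f) (hl : l ≠ ∞) :
    MemLp g 2 := by
  have hsq := h.lintegral_sq_le.trans_lt
    (ENNReal.mul_lt_top hl.lt_top (ENNReal.mul_lt_top (by finiteness) hf.2))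
  exact ⟨h.integrable.1, (eLpNorm_lt_top_iff_lintegral_rpow_enorm_lt_top two_ne_zero
    ENNReal.ofNat_ne_top).2 (by simpa using hsq)⟩

lemma lintegral_bad_le (h : IsCalderonZygmund f g l S) (hf : Integrable f) :
    ∫⁻ x, ‖(f - g) x‖ₑ ≤ 2 * ∫⁻ x, ‖f x‖ₑ :=
  calc ∫⁻ x, ‖(f - g) x‖ₑ ≤ ∫⁻ x, (‖f x‖ₑ + ‖g x‖ₑ) := lintegral_mono fun _ => enorm_sub_le
    _ = (∫⁻ x, ‖f x‖ₑ) + ∫⁻ x, ‖g x‖ₑ := lintegral_add_left' hf.1.enorm _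
    _ ≤ 2 * ∫⁻ x, ‖f x‖ₑ := by
        rw [two_mul]
        grw [h.lintegral_le]

lemma mul_volume_iUnion_cubeBall_le (h : IsCalderonZygmund f g l S) :
    l * volume (⋃ i ∈ S, cubeBall i) ≤
      ENNReal.ofReal ((√n + 1) ^ n) * unitBallVolume n * ∫⁻ x, ‖f x‖ₑ :=
  calc l * volume (⋃ i ∈ S, cubeBall i)
      ≤ l * ∑' i : S, volume (cubeBall i.1) := by
        grw [measure_biUnion_le volume S.to_countable]
    _ = ENNReal.ofReal ((√n + 1) ^ n) * unitBallVolume n * ∑' i : S, l * volume (cube i.1) := by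
        simp only [cubeBall, volume_closedBall_eq_mul_volume_cube _ (by positivity : 0 ≤ √n + 1),
          ENNReal.tsum_mul_left]
        ring
    _ ≤ ENNReal.ofReal ((√n + 1) ^ n) * unitBallVolume n *
          ∑' i : S, ∫⁻ x in cube i.1, ‖f x‖ₑ := by
        gcongr with i
        exact h.mul_volume_le i i.2
    _ ≤ ENNReal.ofReal ((√n + 1) ^ n) * unitBallVolume n * ∫⁻ x, ‖f x‖ₑ := by
        rw [← lintegral_biUnion S.to_countable (fun i _ => measurableSet_cube i)
          h.pairwiseDisjoint]
        grw [setLIntegral_le_lintegral]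

end IsCalderonZygmund

lemma exists_mul_volume_le_intrinsicG_good_le (n : ℕ) (𝕜 : Type*) [RCLike 𝕜] (hα : 0 < α) :
    ∃ C : ℝ≥0, ∀ (f g : EuclideanSpace ℝ (Fin n) → 𝕜) (l : ℝ≥0∞) (S : Set (DyadicIndex n)),
      IsCalderonZygmund f g l S → Integrable f → l ≠ 0 → l ≠ ∞ →
        l * volume {x | l ≤ intrinsicG α g x} ≤ C * ∫⁻ x, ‖f x‖ₑ := by
  obtain ⟨C, hC⟩ := exists_lintegral_intrinsicG_sq_le n 𝕜 hα
  refine ⟨C * 2 ^ n, fun f g l S h hf hl0 hl => ?_⟩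
  rw [← ENNReal.mul_le_mul_iff_right hl0 hl]
  calc l * (l * volume {x | l ≤ intrinsicG α g x})
      ≤ l ^ 2 * volume {x | l ^ 2 ≤ intrinsicG α g x ^ 2} := by
        rw [← mul_assoc, ← sq]
        exact mul_le_mul_right (measure_mono fun x (hx : l ≤ _) => pow_le_pow_left' hx 2) _
    _ ≤ ∫⁻ x, intrinsicG α g x ^ 2 := mul_meas_ge_le_lintegral
        ((measurable_intrinsicG hα h.integrable.locallyIntegrable).pow_const 2) _
    _ ≤ C * ∫⁻ x, ‖g x‖ₑ ^ 2 := hC g (h.memLp_two hf hl)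
    _ ≤ C * (l * (2 ^ n * ∫⁻ x, ‖f x‖ₑ)) := by grw [h.lintegral_sq_le]
    _ = l * ((C * 2 ^ n : ℝ≥0) * ∫⁻ x, ‖f x‖ₑ) := by
        push_cast
        ring

lemma exists_mul_volume_le_intrinsicG_bad_le (n : ℕ) (𝕜 : Type*) [RCLike 𝕜] (hα : 0 < α) :
    ∃ C : ℝ≥0, ∀ (f g : EuclideanSpace ℝ (Fin n) → 𝕜) (l : ℝ≥0∞) (S : Set (DyadicIndex n)),
      IsCalderonZygmund f g l S → Integrable f →
        l * volume ({x | l ≤ intrinsicG α (f - g) x} ∩ (⋃ i ∈ S, cubeBall i)ᶜ) ≤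
          C * ∫⁻ x, ‖f x‖ₑ := by
  obtain ⟨C, hC⟩ := exists_lintegral_compl_iUnion_cubeBall_intrinsicG_le n 𝕜 hα
  refine ⟨C * 2, fun f g l S h hf => ?_⟩
  have hb : Integrable (f - g) := hf.sub h.integrable
  have hG := measurable_intrinsicG hα hb.locallyIntegrable
  rw [← Measure.restrict_apply (measurableSet_le measurable_const hG)]
  calc _ ≤ ∫⁻ x in (⋃ i ∈ S, cubeBall i)ᶜ, intrinsicG α (f - g) x :=
        mul_meas_ge_le_lintegral hG l
    _ ≤ C * ∫⁻ x, ‖(f - g) x‖ₑ := hC (f - g) S hb h.pairwiseDisjoint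
        (fun z hz => sub_eq_zero.2 (h.eq_off z hz).symm) h.setIntegral_eq_zero
    _ ≤ C * (2 * ∫⁻ x, ‖f x‖ₑ) := by grw [h.lintegral_bad_le hf]
    _ = (C * 2 : ℝ≥0) * ∫⁻ x, ‖f x‖ₑ := by
        push_cast
        ring

theorem exists_mul_volume_lt_intrinsicG_le (n : ℕ) [NeZero n] (𝕜 : Type*) [RCLike 𝕜]
    (hα : 0 < α) :
    ∃ C : ℝ≥0, ∀ f : EuclideanSpace ℝ (Fin n) → 𝕜, Integrable f → ∀ l : ℝ≥0∞,
      l * volume {x | l < intrinsicG α f x} ≤ C * ∫⁻ x, ‖f x‖ₑ := by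
  obtain ⟨Cg, hgood⟩ := exists_mul_volume_le_intrinsicG_good_le n 𝕜 hα
  obtain ⟨Cb, hbad⟩ := exists_mul_volume_le_intrinsicG_bad_le n 𝕜 hα
  set V : ℝ≥0∞ := ENNReal.ofReal ((√n + 1) ^ n) * unitBallVolume n
  have hV : V ≠ ∞ := by finiteness [unitBallVolume_ne_top (n := n)]
  refine ⟨2 * (Cg + V.toNNReal + Cb), fun f hf l => ?_⟩
  obtain rfl | hl0 := eq_or_ne l 0
  · simp
  obtain rfl | hl := eq_or_ne l ∞
  · simp
  have hm0 : l / 2 ≠ 0 := (ENNReal.half_pos hl0).ne'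
  obtain ⟨g, S, h⟩ := exists_isCalderonZygmund hf hm0
  have hsub : {x | l < intrinsicG α f x} ⊆ {x | l / 2 ≤ intrinsicG α g x} ∪
      (⋃ i ∈ S, cubeBall i) ∪
        ({x | l / 2 ≤ intrinsicG α (f - g) x} ∩ (⋃ i ∈ S, cubeBall i)ᶜ) := by
    intro x hx
    by_contra hnot
    simp only [mem_union, mem_inter_iff, mem_compl_iff, mem_ofPred_eq] at hnot
    push Not at hnot
    have hadd := intrinsicG_add_le hα h.integrable.locallyIntegrable
      (hf.sub h.integrable).locallyIntegrable x
    rw [add_sub_cancel] at hadd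
    refine absurd hx (not_lt.2 (hadd.trans ?_))
    rw [← ENNReal.add_halves l]
    exact add_le_add hnot.1.1.le (not_le.1 fun hle => hnot.1.2 (hnot.2 hle)).le
  calc l * volume {x | l < intrinsicG α f x}
      ≤ 2 * (l / 2) * (volume {x | l / 2 ≤ intrinsicG α g x} + volume (⋃ i ∈ S, cubeBall i) +
          volume ({x | l / 2 ≤ intrinsicG α (f - g) x} ∩ (⋃ i ∈ S, cubeBall i)ᶜ)) := by
        rw [ENNReal.mul_div_cancel two_ne_zero ENNReal.ofNat_ne_top]
        grw [hsub, measure_union_le, measure_union_le]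
    _ ≤ 2 * (Cg * (∫⁻ x, ‖f x‖ₑ) + V * (∫⁻ x, ‖f x‖ₑ) + Cb * ∫⁻ x, ‖f x‖ₑ) := by
        rw [mul_assoc, mul_add (l / 2), mul_add (l / 2)]
        grw [hgood f g _ S h hf hm0 (by finiteness), h.mul_volume_iUnion_cubeBall_le,
          hbad f g _ S h hf]
    _ = (2 * (Cg + V.toNNReal + Cb) : ℝ≥0) * ∫⁻ x, ‖f x‖ₑ := by
        push_cast
        rw [ENNReal.coe_toNNReal hV]
        ring

/-! ### Morrey spaces -/

section Growth

variable {Φ : ℝ → ℝ} {D : ℝ}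

lemma doubling_const_pos (hpos : ∀ r, 0 < r → 0 < Φ r)
    (hdouble : ∀ r, 0 < r → Φ (2 * r) ≤ D * Φ r) : 0 < D :=
  pos_of_mul_pos_left ((hpos _ two_pos).trans_le (by simpa using hdouble 1 one_pos))
    (hpos 1 one_pos).le

lemma apply_two_pow_mul_le (hpos : ∀ r, 0 < r → 0 < Φ r)
    (hdouble : ∀ r, 0 < r → Φ (2 * r) ≤ D * Φ r) {r : ℝ} (hr : 0 < r) (i : ℕ) :
    Φ (2 ^ i * r) ≤ D ^ i * Φ r := by
  have hD := doubling_const_pos hpos hdouble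
  induction i with
  | zero => simp
  | succ i ih =>
    calc Φ (2 ^ (i + 1) * r) = Φ (2 * (2 ^ i * r)) := by ring_nf
      _ ≤ D * Φ (2 ^ i * r) := hdouble _ (by positivity)
      _ ≤ D * (D ^ i * Φ r) := by gcongr
      _ = D ^ (i + 1) * Φ r := by ring

lemma lintegral_ball_le_morreyNorm (f : 𝔼 → 𝕜) (x₀ : 𝔼) {r : ℝ} (hr : 0 < r)
    (hΦr : 0 < Φ r) :
    ∫⁻ x in ball x₀ r, ‖f x‖ₑ ≤ morreyNorm Φ f * ENNReal.ofReal (Φ r) := by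
  have hne : ENNReal.ofReal (Φ r) ≠ 0 := (ENNReal.ofReal_pos.2 hΦr).ne'
  rw [← ENNReal.div_le_iff hne ENNReal.ofReal_ne_top]
  refine le_sInf fun C hC => ?_
  rw [ENNReal.div_le_iff hne ENNReal.ofReal_ne_top]
  exact hC x₀ r hr

lemma intrinsicA_indicator_compl_ball_eq_zero (f : 𝔼 → 𝕜) {x₀ x : 𝔼} {r t : ℝ}
    (hx : x ∈ ball x₀ r) (ht : 0 < t) (htr : t ≤ r) :
    intrinsicA α ((ball x₀ (2 * r))ᶜ.indicator f) x t = 0 := by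
  refine le_antisymm (intrinsicA_indicator_le measurableSet_ball.compl ht fun ψ hψ => ?_)
    zero_le
  rw [setIntegral_eq_zero_of_forall_eq_zero fun z hz => ?_, enorm_zero]
  rw [hψ.eq_zero z fun hzx => hz ?_, zero_mul]
  rw [mem_closedBall] at hzx
  rw [mem_ball] at hx ⊢
  linarith [dist_triangle z x x₀]

lemma intrinsicA_indicator_le_morreyNorm (hα : 0 < α) (f : 𝔼 → 𝕜) (s : Set 𝔼) (x : 𝔼)
    {t : ℝ} (ht : 0 < t) (hΦt : 0 < Φ (2 * t)) :
    intrinsicA α (s.indicator f) x t ≤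
      ENNReal.ofReal (2 ^ α * (t ^ n)⁻¹ * Φ (2 * t)) * morreyNorm Φ f :=
  calc intrinsicA α (s.indicator f) x t
      ≤ ENNReal.ofReal (2 ^ α * (t ^ n)⁻¹) * ∫⁻ z in closedBall x t, ‖s.indicator f z‖ₑ :=
        intrinsicA_le_lintegral hα _ x ht
    _ ≤ ENNReal.ofReal (2 ^ α * (t ^ n)⁻¹) * ∫⁻ z in ball x (2 * t), ‖f z‖ₑ := by
        gcongr with z
        · exact closedBall_subset_ball (by linarith)
        · exact enorm_indicator_le_enorm_self f z
    _ ≤ ENNReal.ofReal (2 ^ α * (t ^ n)⁻¹) * (morreyNorm Φ f * ENNReal.ofReal (Φ (2 * t))) := by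
        grw [lintegral_ball_le_morreyNorm f x (by positivity) hΦt]
    _ = _ := by
        rw [ENNReal.ofReal_mul (q := Φ (2 * t)) (by positivity)]
        ring

lemma intrinsicA_indicator_two_pow_mul_le (hα : 0 < α) (hpos : ∀ r, 0 < r → 0 < Φ r)
    (hdouble : ∀ r, 0 < r → Φ (2 * r) ≤ D * Φ r) (f : 𝔼 → 𝕜) (s : Set 𝔼) (x : 𝔼) {r : ℝ}
    (hr : 0 < r) (i : ℕ) :
    intrinsicA α (s.indicator f) x (2 ^ i * r) ≤ ENNReal.ofReal (2 ^ α * D) *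
      (morreyNorm Φ f * ENNReal.ofReal ((r ^ n)⁻¹ * Φ r)) * ENNReal.ofReal (D / 2 ^ n) ^ i := by
  have hD := doubling_const_pos hpos hdouble
  have hΦr := hpos r hr
  have hle : 2 ^ α * ((2 ^ i * r) ^ n)⁻¹ * Φ (2 * (2 ^ i * r)) ≤
      2 ^ α * D * ((r ^ n)⁻¹ * Φ r) * (D / 2 ^ n) ^ i := by
    rw [← mul_assoc 2, ← pow_succ']
    grw [apply_two_pow_mul_le hpos hdouble hr (i + 1)]
    rw [div_pow, mul_pow, ← pow_mul, ← pow_mul, mul_comm n]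
    exact le_of_eq (by ring)
  grw [intrinsicA_indicator_le_morreyNorm hα f s x (by positivity) (hpos _ (by positivity)), hle]
  rw [ENNReal.ofReal_mul (by positivity), ENNReal.ofReal_mul (by positivity),
    ENNReal.ofReal_pow (by positivity)]
  exact le_of_eq (by ring)

lemma exists_intrinsicG_indicator_compl_ball_le (𝕜 : Type*) [RCLike 𝕜] (hα : 0 < α)
    (hpos : ∀ r, 0 < r → 0 < Φ r) (hdouble : ∀ r, 0 < r → Φ (2 * r) ≤ D * Φ r)
    (hD : D < 2 ^ n) :
    ∃ C : ℝ≥0, ∀ (f : 𝔼 → 𝕜) (x₀ x : 𝔼) (r : ℝ), x ∈ ball x₀ r →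
      intrinsicG α ((ball x₀ (2 * r))ᶜ.indicator f) x ≤
        C * (morreyNorm Φ f * ENNReal.ofReal ((r ^ n)⁻¹ * Φ r)) := by
  set q : ℝ≥0∞ := ENNReal.ofReal (D / 2 ^ n)
  have hq : q < 1 := ENNReal.ofReal_lt_one.2 ((div_lt_one (by positivity)).2 hD)
  set K : ℝ≥0∞ := ENNReal.ofReal (2 ^ n * 2 ^ α) * (ENNReal.ofReal (2 ^ α * D) * (1 - q)⁻¹)
  have hK : K ≠ ∞ := by finiteness [(tsub_pos_of_lt hq).ne']
  refine ⟨K.toNNReal, fun f x₀ x r hx => ?_⟩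
  rw [ENNReal.coe_toNNReal hK]
  have hr : 0 < r := pos_of_mem_ball hx
  set N : ℝ≥0∞ := morreyNorm Φ f * ENNReal.ofReal ((r ^ n)⁻¹ * Φ r)
  set f' := (ball x₀ (2 * r))ᶜ.indicator f
  have hfar : ∀ i : ℕ, intrinsicA α f' x (2 ^ (i : ℤ) * r) ≤
      ENNReal.ofReal (2 ^ α * D) * N * q ^ i := fun i => by
    rw [zpow_natCast]
    exact intrinsicA_indicator_two_pow_mul_le hα hpos hdouble f _ x hr i
  have hnear : Function.support (fun k : ℤ => intrinsicA α f' x (2 ^ k * r)) ⊆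
      range ((↑) : ℕ → ℤ) := fun k hk => by
    by_contra hneg
    have hk0 : k ≤ 0 := le_of_not_gt fun hlt => hneg ⟨k.toNat, Int.toNat_of_nonneg hlt.le⟩
    exact hk (intrinsicA_indicator_compl_ball_eq_zero f hx (by positivity)
      (mul_le_of_le_one_left hr.le (zpow_le_one_of_nonpos₀ one_le_two hk0)))
  calc intrinsicG α f' x
      ≤ ENNReal.ofReal (2 ^ n * 2 ^ α) * ∑' k : ℤ, intrinsicA α f' x (2 ^ k * r) :=
        intrinsicG_le_tsum hα f' x hr
    _ ≤ ENNReal.ofReal (2 ^ n * 2 ^ α) * ∑' i : ℕ, ENNReal.ofReal (2 ^ α * D) * N * q ^ i := by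
        rw [← Nat.cast_injective.tsum_eq hnear]
        grw [ENNReal.tsum_le_tsum hfar]
    _ = K * N := by
        rw [ENNReal.tsum_mul_left, ENNReal.tsum_geometric]
        ring

lemma exists_mul_volume_lt_intrinsicG_indicator_ball_le (n : ℕ) [NeZero n] (𝕜 : Type*)
    [RCLike 𝕜] (hα : 0 < α) (hpos : ∀ r, 0 < r → 0 < Φ r)
    (hdouble : ∀ r, 0 < r → Φ (2 * r) ≤ D * Φ r) :
    ∃ C : ℝ≥0, ∀ f : EuclideanSpace ℝ (Fin n) → 𝕜, LocallyIntegrable f →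
      ∀ (x₀ : EuclideanSpace ℝ (Fin n)) (r : ℝ), 0 < r → ∀ l : ℝ≥0∞,
        l * volume {x | l < intrinsicG α ((ball x₀ (2 * r)).indicator f) x} ≤
          C * (morreyNorm Φ f * ENNReal.ofReal (Φ r)) := by
  obtain ⟨C, hC⟩ := exists_mul_volume_lt_intrinsicG_le n 𝕜 hα
  refine ⟨C * D.toNNReal, fun f hf x₀ r hr l => ?_⟩
  have hint : IntegrableOn f (ball x₀ (2 * r)) :=
    (hf.integrableOn_isCompact (isCompact_closedBall x₀ (2 * r))).mono_set ball_subset_closedBall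
  refine (hC _ (hint.integrable_indicator measurableSet_ball) l).trans ?_
  simp only [enorm_indicator_eq_indicator_enorm]
  rw [lintegral_indicator measurableSet_ball]
  grw [lintegral_ball_le_morreyNorm f x₀ (by positivity) (hpos (2 * r) (by positivity)),
    hdouble r hr]
  rw [ENNReal.ofReal_mul (doubling_const_pos hpos hdouble).le, ENNReal.coe_mul]
  exact le_of_eq (by rw [ENNReal.ofReal]; ring)

lemma mul_volume_mem_ball_lt_le {h : 𝔼 → ℝ≥0∞} {x₀ : 𝔼} {r : ℝ} (hr : 0 ≤ r) {M : ℝ≥0∞}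
    (hM : ∀ x ∈ ball x₀ r, h x ≤ M) (l : ℝ≥0∞) :
    l * volume {x | x ∈ ball x₀ r ∧ l < h x} ≤
      M * (ENNReal.ofReal (r ^ n) * unitBallVolume n) := by
  obtain hempty | ⟨x, hx, hlt⟩ := eq_empty_or_nonempty {x | x ∈ ball x₀ r ∧ l < h x}
  · rw [hempty, measure_empty, mul_zero]
    exact zero_le
  · rw [← volume_closedBall_eq x₀ hr]
    gcongr
    · exact hlt.le.trans (hM x hx)
    · exact fun y hy => ball_subset_closedBall hy.1

theorem exists_mul_volume_mem_ball_lt_intrinsicG_le (n : ℕ) [NeZero n] (𝕜 : Type*) [RCLike 𝕜]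
    (hα : 0 < α) (hpos : ∀ r, 0 < r → 0 < Φ r) (hdouble : ∀ r, 0 < r → Φ (2 * r) ≤ D * Φ r)
    (hD : D < 2 ^ n) :
    ∃ C : ℝ≥0, ∀ f : EuclideanSpace ℝ (Fin n) → 𝕜, LocallyIntegrable f →
      ∀ (x₀ : EuclideanSpace ℝ (Fin n)) (r : ℝ), 0 < r → ∀ l : ℝ≥0∞,
        l * volume {x | x ∈ ball x₀ r ∧ l < intrinsicG α f x} ≤
          C * morreyNorm Φ f * ENNReal.ofReal (Φ r) := by
  obtain ⟨Cn, hnear⟩ := exists_mul_volume_lt_intrinsicG_indicator_ball_le n 𝕜 hα hpos hdouble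
  obtain ⟨Cf, hfar⟩ := exists_intrinsicG_indicator_compl_ball_le 𝕜 hα hpos hdouble hD
  refine ⟨2 * (Cn + Cf * (unitBallVolume n).toNNReal), fun f hf x₀ r hr l => ?_⟩
  set f₁ := (ball x₀ (2 * r)).indicator f
  set f₂ := (ball x₀ (2 * r))ᶜ.indicator f
  have hsub : {x | x ∈ ball x₀ r ∧ l < intrinsicG α f x} ⊆ {x | l / 2 < intrinsicG α f₁ x} ∪
      {x | x ∈ ball x₀ r ∧ l / 2 < intrinsicG α f₂ x} := by
    rintro x ⟨hx, hlt⟩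
    by_contra hnot
    simp only [mem_union, mem_ofPred_eq, not_or, not_and, not_lt] at hnot
    have hball : MeasurableSet (ball x₀ (2 * r)) := measurableSet_ball
    have hadd := intrinsicG_add_le hα (hf.indicator hball) (hf.indicator hball.compl) x
    rw [indicator_self_add_compl] at hadd
    refine absurd hlt (not_lt.2 (hadd.trans ?_))
    rw [← ENNReal.add_halves l]
    exact add_le_add hnot.1 (hnot.2 hx)
  have hscale : ENNReal.ofReal ((r ^ n)⁻¹ * Φ r) * ENNReal.ofReal (r ^ n) =
      ENNReal.ofReal (Φ r) := by
    rw [← ENNReal.ofReal_mul (mul_nonneg (by positivity) (hpos r hr).le)]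
    congr 1
    field_simp
  calc l * volume {x | x ∈ ball x₀ r ∧ l < intrinsicG α f x}
      ≤ 2 * (l / 2) * (volume {x | l / 2 < intrinsicG α f₁ x} +
          volume {x | x ∈ ball x₀ r ∧ l / 2 < intrinsicG α f₂ x}) := by
        rw [ENNReal.mul_div_cancel two_ne_zero ENNReal.ofNat_ne_top]
        grw [hsub, measure_union_le]
    _ ≤ 2 * (Cn * (morreyNorm Φ f * ENNReal.ofReal (Φ r)) +
          Cf * (morreyNorm Φ f * ENNReal.ofReal ((r ^ n)⁻¹ * Φ r)) *
            (ENNReal.ofReal (r ^ n) * unitBallVolume n)) := by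
        rw [mul_assoc, mul_add (l / 2)]
        grw [hnear f hf x₀ r hr, mul_volume_mem_ball_lt_le hr.le fun x hx => hfar f x₀ x r hx]
    _ = (2 * (Cn + Cf * (unitBallVolume n).toNNReal) : ℝ≥0) * morreyNorm Φ f *
          ENNReal.ofReal (Φ r) := by
        push_cast
        rw [ENNReal.coe_toNNReal unitBallVolume_ne_top, ← hscale]
        ring

lemma ae_lt_top_of_weakMorreyNorm_lt_top {h : 𝔼 → ℝ≥0∞} (hh : weakMorreyNorm Φ h < ∞) :
    ∀ᵐ x, h x < ∞ := by
  obtain ⟨C, hC, hCtop⟩ := sInf_lt_iff.1 hh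
  have hnull : ∀ N : ℕ, volume {x | x ∈ ball (0 : 𝔼) (N + 1) ∧ h x = ∞} = 0 := fun N => by
    by_contra hne
    obtain ⟨s, hs⟩ := ENNReal.exists_nat_mul_gt hne
      (by finiteness : C * ENNReal.ofReal (Φ (N + 1)) ≠ ∞)
    have hs0 : (0 : ℝ) < s := Nat.cast_pos.2 (Nat.pos_of_ne_zero fun h0 => by simp [h0] at hs)
    refine hs.not_ge (le_trans ?_
      ((le_iSup₂ (s : ℝ) hs0).trans (hC 0 (N + 1) (by positivity))))
    rw [ENNReal.ofReal_natCast]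
    gcongr
    exact fun htop => htop ▸ ENNReal.natCast_lt_top s
  rw [ae_iff]
  refine measure_mono_null (fun x hx => ?_) (measure_iUnion_null hnull)
  obtain ⟨N, hN⟩ := exists_nat_gt ‖x‖
  exact mem_iUnion.2 ⟨N, mem_ball_zero_iff.2 (by linarith), not_lt_top_iff.1 hx⟩

end Growth

end IntrinsicSquare

end

open IntrinsicSquare in
theorem corollary1p8_general {n : ℕ} [NeZero n] {𝕜 : Type*} [RCLike 𝕜] {α : ℝ}
    (hα : 0 < α) {Φ : ℝ → ℝ} {D : ℝ} (hpos : ∀ r, 0 < r → 0 < Φ r)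
    (hdouble : ∀ r, 0 < r → Φ (2 * r) ≤ D * Φ r) (hD : D < 2 ^ n) :
    ∃ C : ℝ≥0, 0 < C ∧ ∀ f : EuclideanSpace ℝ (Fin n) → 𝕜, MemMorrey Φ f →
      MemWeakMorrey Φ (intrinsicG α f) ∧
        weakMorreyNorm Φ (intrinsicG α f) ≤ C * morreyNorm Φ f := by
  obtain ⟨C, hC⟩ := exists_mul_volume_mem_ball_lt_intrinsicG_le n 𝕜 hα hpos hdouble hD
  refine ⟨C + 1, by positivity, fun f hf => ?_⟩
  have hle : weakMorreyNorm Φ (intrinsicG α f) ≤ (C + 1 : ℝ≥0) * morreyNorm Φ f := by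
    have hCf : weakMorreyNorm Φ (intrinsicG α f) ≤ C * morreyNorm Φ f :=
      sInf_le fun x₀ r hr => iSup₂_le fun s _ => hC f hf.locallyIntegrable x₀ r hr _
    grw [hCf, ← le_self_add (a := C)]
  have hlt := hle.trans_lt (ENNReal.mul_lt_top ENNReal.coe_lt_top hf.norm_lt_top)
  exact ⟨⟨measurable_intrinsicG hα hf.locallyIntegrable, ae_lt_top_of_weakMorreyNorm_lt_top hlt,
    hlt⟩, hle⟩

theorem corollary1p8 {n : ℕ} {𝕜 : Type*} [RCLike 𝕜] (α : ℝ) (hα : 0 < α) (hα1 : α ≤ 1)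
    (Φ : ℝ → ℝ) (D : ℝ) (hΦ : IntrinsicSquare.IsGrowthFunction Φ D) (hD : D < 2 ^ n) :
    ∃ C : ℝ≥0, 0 < C ∧ ∀ f : EuclideanSpace ℝ (Fin n) → 𝕜,
      IntrinsicSquare.MemMorrey Φ f →
        IntrinsicSquare.MemWeakMorrey Φ (IntrinsicSquare.intrinsicG α f) ∧
        IntrinsicSquare.weakMorreyNorm Φ (IntrinsicSquare.intrinsicG α f) ≤
          C * IntrinsicSquare.morreyNorm Φ f := by
  have : NeZero n := ⟨by
    rintro rfl
    linarith [hΦ.one_le]⟩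
  exact corollary1p8_general hα hΦ.pos hΦ.doubling hD
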